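/- **Conventions.** An *$\mathcal F$-category* $\mathbb A$ is a (strict) 2-category $\mathcal A_\lambda$, whose 1-cells are called *loose*, together with a class of *tight* 1-cells that contains the identities and is closed under composition; $\mathcal A_\tau$ denotes the 2-category with the same objects, the tight 1-cells, and all 2-cells between them. An *$\mathcal F$-functor* $\mathbb A\to\mathbb B$ is a 2-functor $\mathcal A_\lambda\to\mathcal B_\lambda$ that preserves tightness; $\mathcal F\text{-CAT}$ is the category of $\mathcal F$-categories and $\mathcal F$-functors. A 2-category is viewed as an $\mathcal F$-category in which all 1-cells are tight. The inclusion of tight 1-cells is an $\mathcal F$-functor $j:\mathcal A_\tau\to\mathbb A$. $\mathbb A^{co}$ is obtained by reversing the 2-cells, with the same tight 1-cells. Composites are written $g\cdot f$, and also denote whiskering. **Limits.** For a loose $f:A\to B$, a *colax cone* with base $X$ is $(r,\alpha,s)$ with $r:X\to A$, $s:X\to B$ and $\alpha:s\Rightarrow f\cdot r$; it is a *pseudo-cone* if $\alpha$ is invertible. A *colax limit* (resp. *pseudolimit*) of $f$ is an object $C$ with a colax cone (resp. pseudo-cone) $(p,\lambda,q)$ with base $C$, where $p,q$ are tight, such that: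 (1) for each colax cone (resp. pseudo-cone) $(r,\alpha,s)$ with base $X$ there is a unique loose $t:X\to C$ with $p\cdot t=r$, $q\cdot t=s$, $\lambda\cdot t=\alpha$; (2) given two such cones $(r,\alpha,s)$, $(r',\alpha',s')$ with base $X$ and factorisations $t,t'$, and 2-cells $\theta_r:r\Rightarrow r'$, $\theta_s:s\Rightarrow s'$ with $\alpha'\circ\theta_s=(f\cdot\theta_r)\circ\alpha$, there is a unique 2-cell $\phi:t\Rightarrow t'$ with $p\cdot\phi=\theta_r$ and $q\cdot\phi=\theta_s$; (3) $t:X\to C$ is tight if and only if $p\cdot t$ and $q\cdot t$ are. A *lax limit* in $\mathbb A$ is a colax limit in $\mathbb A^{co}$. For $w=l,p,c$ a $w$-limit is a lax limit, pseudolimit, colax limit respectively, and $\bar l=c$, $\bar p=p$, $\bar c=l$. **Doctrinal $\mathcal F$-functors.** An *$l$-reflection* on $f$ in $\mathbb A$ is an adjunction $(1,f\dashv g,\eta)$ in $\mathcal A_\lambda$ with tight left adjoint $f$ and identity counit; it is a *$p$-reflection* if $\eta$ is also invertible. For $w\in\{l,p\}$, given $w$-reflections $(1,f_1\dashv g_1,\eta_1)$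 and $(1,f_2\dashv g_2,\eta_2)$, a commuting square of tight 1-cells $f_2\cdot r=s\cdot f_1$ is a *morphism of $w$-reflections* if $r\cdot g_1=g_2\cdot s$ and $r\cdot\eta_1=\eta_2\cdot r$. For $w\in\{l,p\}$ an $\mathcal F$-functor $H:\mathbb A\to\mathbb B$ satisfies * *$w$-Refl* if for each tight $f$ in $\mathbb A$, each $w$-reflection on $Hf$ in $\mathbb B$ is the image under $H$ of a unique $w$-reflection on $f$ in $\mathbb A$; * *$w$-Morph* if for all $w$-reflections on $f_1$ and $f_2$ in $\mathbb A$, a tight commuting square $(r,s):f_1\to f_2$ is a morphism of $w$-reflections if and only if its image $(Hr,Hs):Hf_1\to Hf_2$ is one between the image $w$-reflections. $H$ satisfies $c$-Refl, $c$-Morph if $H^{co}$ satisfies $l$-Refl, $l$-Morph. For $w\in\{l,p,c\}$, $H$ is *$w$-doctrinal* if it satisfies $w$-Refl and $w$-Morph and is locally faithful (reflects equality of parallel 2-cells of $\mathcal A_\lambda$); $w\text{-Doct}$ is the class of $w$-doctrinal $\mathcal F$-functors. **Orthogonality.** A morphism $e:X\to Y$ is *orthogonal* to $m:Z\to W$ if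 for all $r:X\to Z$, $s:Y\to W$ with $m r=s e$ there is a unique $k:Y\to Z$ with $k e=r$ and $m k=s$. For a class $M$, ${}^{\bot}M$ is the class of morphisms orthogonal to every member of $M$. An *orthogonal $(E,M)$-decomposition* of $f$ is a factorisation $f=m e$ with $e\in E$ and $m\in M$, where every member of $E$ is orthogonal to every member of $M$. **Corollary.** Let $w\in\{l,p,c\}$. Let $\mathbb A$ be an $\mathcal F$-category that has $\bar w$-limits of all loose 1-cells, let $\mathcal B$ be a 2-category, and let $H:\mathbb A\to\mathcal B$ be a $w$-doctrinal $\mathcal F$-functor. Let $H_\tau:\mathcal A_\tau\to\mathcal B$ be the 2-functor given by restricting $H$ to tight 1-cells. Then $$\mathcal A_\tau\xrightarrow{\;j\;}\mathbb A\xrightarrow{\;H\;}\mathcal B$$ is an orthogonal $({}^{\bot}w\text{-Doct},\,w\text{-Doct})$-decomposition of $H_\tau$ in $\mathcal F\text{-CAT}$. -/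

import Mathlib

open CategoryTheory Bicategory

universe w v u w₁ v₁ u₁ w₂ v₂ u₂

/-! ### Strict 2-categories and strict 2-functors -/

/-- A (strict) 2-category: a strict bicategory, bundled.  Composition of 1-cells `f ≫ g` is written
in diagrammatic order, so `f ≫ g` is `g ∘ f`. -/
structure TwoCat where
  obj : Type u
  [bicat : Bicategory.{w, v} obj]
  [strict : Bicategory.Strict obj]

attribute [instance] TwoCat.bicat TwoCat.strict

/-- Equality of 2-cells in a strict bicategory.  Because 1-cells which are equal (such as
`(f ≫ g) ≫ h` and `f ≫ (g ≫ h)`) need not be syntactically equal, two 2-cells are the same if their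
sources and targets are equal 1-cells and they agree under these identifications. -/
def SameCell {B : Type u} [Bicategory.{w, v} B] {a b : B} {f g f' g' : a ⟶ b}
    (α : f ⟶ g) (β : f' ⟶ g') : Prop :=
  ∃ (hf : f = f') (hg : g = g'), eqToHom hf ≫ β = α ≫ eqToHom hg

/-- A 2-functor is determined by its action on objects, 1-cells and 2-cells. -/
theorem strictPseudofunctor_ext {B : Type u₁} [Bicategory.{w₁, v₁} B] {C : Type u₂}
    [Bicategory.{w₂, v₂} C] {F G : StrictPseudofunctor B C}
    (h : F.toPrelaxFunctor = G.toPrelaxFunctor) : F = G := by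
  obtain ⟨⟨⟨F, a, b, _, _, _, _, _⟩, hi, hi'⟩, hc, hc'⟩ := F
  obtain ⟨⟨⟨G, a', b', _, _, _, _, _⟩, ki, ki'⟩, kc, kc'⟩ := G
  change F = G at h
  subst h
  obtain rfl : a = a' := by
    funext x; exact (hi' x).trans (ki' x).symm
  obtain rfl : @b = @b' := by
    funext x y z f g; exact (hc' f g).trans (kc' f g).symm
  rfl

theorem strictPseudofunctor_whiskerLeft {B : Type u₁} [Bicategory.{w₁, v₁} B] {C : Type u₂}
    [Bicategory.{w₂, v₂} C] (F : StrictPseudofunctor B C) {a b c : B} (f : a ⟶ b) {g g' : b ⟶ c}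
    (η : g ⟶ g') :
    F.map₂ (f ◁ η) = eqToHom (F.map_comp f g) ≫ F.map f ◁ F.map₂ η ≫
      eqToHom (F.map_comp f g').symm := by
  simp [F.map₂_whisker_left, F.mapComp_eq_eqToIso]

theorem strictPseudofunctor_whiskerRight {B : Type u₁} [Bicategory.{w₁, v₁} B] {C : Type u₂}
    [Bicategory.{w₂, v₂} C] (F : StrictPseudofunctor B C) {a b c : B} {f f' : a ⟶ b} (η : f ⟶ f')
    (g : b ⟶ c) :
    F.map₂ (η ▷ g) = eqToHom (F.map_comp f g) ≫ F.map₂ η ▷ F.map g ≫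
      eqToHom (F.map_comp f' g).symm := by
  simp [F.map₂_whisker_right, F.mapComp_eq_eqToIso]

/-! ### F-categories and F-functors -/

/-- An F-category: a 2-category, whose 1-cells are called loose, with a class of tight 1-cells
which contains the identities and is closed under composition. -/
structure FCat extends TwoCat.{w, v, u} where
  Tight : ∀ {a b : obj}, (a ⟶ b) → Prop
  tight_id : ∀ a : obj, Tight (𝟙 a)
  tight_comp : ∀ {a b c : obj} (f : a ⟶ b) (g : b ⟶ c), Tight f → Tight g → Tight (f ≫ g)

/-- An F-functor: a 2-functor between the 2-categories of loose 1-cells which preserves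
tightness. -/
structure FFunctor (A : FCat.{w₁, v₁, u₁}) (B : FCat.{w₂, v₂, u₂}) extends
    StrictPseudofunctor A.obj B.obj where
  map_tight : ∀ {a b : A.obj} (f : a ⟶ b), A.Tight f → B.Tight (map f)

namespace FFunctor

theorem ext_prelax {A : FCat.{w₁, v₁, u₁}} {B : FCat.{w₂, v₂, u₂}} {F G : FFunctor A B}
    (h : F.toPrelaxFunctor = G.toPrelaxFunctor) : F = G := by
  obtain ⟨F, _⟩ := F
  obtain ⟨G, _⟩ := G
  obtain rfl : F = G := strictPseudofunctor_ext h
  rfl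

/-- The identity F-functor. -/
def id (A : FCat.{w, v, u}) : FFunctor A A where
  toStrictPseudofunctor := StrictPseudofunctor.id A.obj
  map_tight _ h := h

/-- Composition of F-functors. -/
def comp {A B C : FCat.{w, v, u}} (F : FFunctor A B) (G : FFunctor B C) : FFunctor A C where
  toStrictPseudofunctor := F.toStrictPseudofunctor.comp G.toStrictPseudofunctor
  map_tight _ h := G.map_tight _ (F.map_tight _ h)

end FFunctor

/-- The category F-CAT of F-categories and F-functors. -/
instance FCat.category : Category FCat.{w, v, u} where
  Hom A B := FFunctor A B
  id A := FFunctor.id A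
  comp F G := FFunctor.comp F G
  id_comp _ := FFunctor.ext_prelax rfl
  comp_id _ := FFunctor.ext_prelax rfl
  assoc _ _ _ := FFunctor.ext_prelax rfl

/-- A 2-category viewed as an F-category in which all 1-cells are tight. -/
def TwoCat.toFCat (B : TwoCat.{w, v, u}) : FCat.{w, v, u} where
  toTwoCat := B
  Tight _ := True
  tight_id _ := trivial
  tight_comp _ _ _ _ := trivial

/-- A 2-functor viewed as an F-functor between 2-categories. -/
def TwoCat.toFFunctor {B C : TwoCat.{w, v, u}} (F : StrictPseudofunctor B.obj C.obj) :
    B.toFCat ⟶ C.toFCat :=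
  FFunctor.mk F (fun _ _ => trivial)

/-! ### The 2-category of tight 1-cells -/

/-- The objects of the 2-category of tight 1-cells: those of the F-category itself. -/
def TightObj (A : FCat.{w, v, u}) : Type u := A.obj

/-- The underlying object. -/
def TightObj.un {A : FCat.{w, v, u}} (a : TightObj A) : A.obj := a

namespace TightObj

variable (A : FCat.{w, v, u})

/-- The 1-cells are the tight ones. -/
instance categoryStruct : CategoryStruct.{v} (TightObj A) where
  Hom a b := { f : a.un ⟶ b.un // A.Tight f }
  id a := ⟨𝟙 a.un, A.tight_id a.un⟩
  comp f g := ⟨f.1 ≫ g.1, A.tight_comp _ _ f.2 g.2⟩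

/-- The 2-cells are all 2-cells between tight 1-cells. -/
instance homCategory (a b : TightObj A) : Category.{w} (a ⟶ b) where
  Hom f g := f.1 ⟶ g.1
  id f := 𝟙 f.1
  comp {f g h} α β := @CategoryStruct.comp (a.un ⟶ b.un) _ f.1 g.1 h.1 α β
  id_comp _ := Category.id_comp (obj := (a.un ⟶ b.un)) _
  comp_id _ := Category.comp_id (obj := (a.un ⟶ b.un)) _
  assoc _ _ _ := Category.assoc (obj := (a.un ⟶ b.un)) _ _ _

variable {A}

/-- An invertible 2-cell between tight 1-cells. -/
def isoMk {a b : TightObj A} {f g : a ⟶ b} (e : f.1 ≅ g.1) : f ≅ g where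
  hom := e.hom
  inv := e.inv
  hom_inv_id := e.hom_inv_id
  inv_hom_id := e.inv_hom_id

variable (A)

instance bicategory : Bicategory.{w, v} (TightObj A) where
  whiskerLeft f _ _ η := Bicategory.whiskerLeft (B := A.obj) f.1 η
  whiskerRight η h := Bicategory.whiskerRight (B := A.obj) η h.1
  associator f g h := isoMk (Bicategory.associator (B := A.obj) f.1 g.1 h.1)
  leftUnitor f := isoMk (Bicategory.leftUnitor (B := A.obj) f.1)
  rightUnitor f := isoMk (Bicategory.rightUnitor (B := A.obj) f.1)
  whiskerLeft_id _ _ := Bicategory.whiskerLeft_id (B := A.obj) _ _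
  whiskerLeft_comp _ _ _ _ _ _ := Bicategory.whiskerLeft_comp (B := A.obj) _ _ _
  id_whiskerLeft _ := Bicategory.id_whiskerLeft (B := A.obj) _
  comp_whiskerLeft _ _ _ _ _ := Bicategory.comp_whiskerLeft (B := A.obj) _ _ _
  id_whiskerRight _ _ := Bicategory.id_whiskerRight (B := A.obj) _ _
  comp_whiskerRight _ _ _ := Bicategory.comp_whiskerRight (B := A.obj) _ _ _
  whiskerRight_id _ := Bicategory.whiskerRight_id (B := A.obj) _
  whiskerRight_comp _ _ _ := Bicategory.whiskerRight_comp (B := A.obj) _ _ _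
  whisker_assoc _ _ _ _ _ := Bicategory.whisker_assoc (B := A.obj) _ _ _
  whisker_exchange _ _ := Bicategory.whisker_exchange (B := A.obj) _ _
  pentagon _ _ _ _ := Bicategory.pentagon (B := A.obj) _ _ _ _
  triangle _ _ := Bicategory.triangle (B := A.obj) _ _

variable {A}

theorem isoMk_eqToIso {a b : TightObj A} {f g : a ⟶ b} (e : f.1 ≅ g.1) (h : f = g)
    (he : e = eqToIso (congrArg Subtype.val h)) : isoMk e = eqToIso h := by
  subst h; subst he; rfl

instance strict : Bicategory.Strict (TightObj A) where
  id_comp _ := Subtype.ext (Strict.id_comp (B := A.obj) _)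
  comp_id _ := Subtype.ext (Strict.comp_id (B := A.obj) _)
  assoc _ _ _ := Subtype.ext (Strict.assoc (B := A.obj) _ _ _)
  leftUnitor_eqToIso _ := isoMk_eqToIso _ _ (Strict.leftUnitor_eqToIso (B := A.obj) _)
  rightUnitor_eqToIso _ := isoMk_eqToIso _ _ (Strict.rightUnitor_eqToIso (B := A.obj) _)
  associator_eqToIso _ _ _ := isoMk_eqToIso _ _ (Strict.associator_eqToIso (B := A.obj) _ _ _)

end TightObj

/-- The 2-category of tight 1-cells of an F-category, with all 2-cells between them. -/
def FCat.tight (A : FCat.{w, v, u}) : TwoCat.{w, v, u} where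
  obj := TightObj A

/-- The restriction to tight 1-cells of a 2-functor defined on loose 1-cells. -/
def TightObj.restrict {A : FCat.{w, v, u}} {C : TwoCat.{w, v, u}}
    (F : StrictPseudofunctor A.obj C.obj) : StrictPseudofunctor A.tight.obj C.obj :=
  StrictPseudofunctor.mk'' (B := TightObj A) (C := C.obj)
    { obj := fun a => F.obj (TightObj.un a)
      map := fun {a b} f => F.map (X := TightObj.un a) (Y := TightObj.un b) f.1
      map₂ := fun η => F.map₂ η
      map₂_id := fun _ => F.map₂_id _
      map₂_comp := fun _ _ => F.map₂_comp _ _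
      map_id := fun _ => F.map_id _
      map_comp := fun _ _ => F.map_comp _ _
      map₂_whisker_left := fun f _ _ η => strictPseudofunctor_whiskerLeft F f.1 η
      map₂_whisker_right := fun η g => strictPseudofunctor_whiskerRight F η g.1 }

/-- The inclusion `j` of the 2-category of tight 1-cells into the F-category. -/
def FCat.j (A : FCat.{w, v, u}) : A.tight.toFCat ⟶ A :=
  FFunctor.mk (TightObj.restrict (C := A.toTwoCat) (StrictPseudofunctor.id A.obj))
    (fun (f : { f // A.Tight f }) _ => f.2)

/-- For an F-functor `H` from an F-category to a 2-category, the 2-functor `H_τ` from the 2-category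
of tight 1-cells. -/
def FFunctor.tau {A : FCat.{w, v, u}} {B : TwoCat.{w, v, u}} (H : A ⟶ B.toFCat) :
    StrictPseudofunctor A.tight.obj B.obj :=
  TightObj.restrict (C := B) (FFunctor.toStrictPseudofunctor H)

/-! ### The duality reversing 2-cells -/

/-- The objects of the dual of a bicategory with reversed 2-cells. -/
def Co (B : Type u) : Type u := B

/-- The underlying object. -/
def Co.un {B : Type u} (a : Co B) : B := a

namespace Co

variable (B : Type u) [Bicategory.{w, v} B]

instance categoryStruct : CategoryStruct.{v} (Co B) where
  Hom a b := a.un ⟶ b.un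
  id a := 𝟙 a.un
  comp {a b c} f g := @CategoryStruct.comp B _ a.un b.un c.un f g

/-- A 2-cell `f ⟶ g` of the dual is a 2-cell `g ⟶ f`. -/
instance homCategory (a b : Co B) : Category.{w} (a ⟶ b) where
  Hom f g := @Quiver.Hom (a.un ⟶ b.un) _ g f
  id f := @CategoryStruct.id (a.un ⟶ b.un) _ f
  comp {f g h} α β := @CategoryStruct.comp (a.un ⟶ b.un) _ h g f β α
  id_comp _ := Category.comp_id (obj := (a.un ⟶ b.un)) _
  comp_id _ := Category.id_comp (obj := (a.un ⟶ b.un)) _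
  assoc _ _ _ := (Category.assoc (obj := (a.un ⟶ b.un)) _ _ _).symm

variable {B}

/-- An invertible 2-cell gives one of the dual, in the same direction. -/
def isoMk {a b : Co B} {f g : a ⟶ b} (e : @Iso (a.un ⟶ b.un) _ f g) : f ≅ g where
  hom := e.inv
  inv := e.hom
  hom_inv_id := e.hom_inv_id
  inv_hom_id := e.inv_hom_id

variable (B)

instance bicategory : Bicategory.{w, v} (Co B) where
  homCategory a b := homCategory B a b
  whiskerLeft f _ _ η := Bicategory.whiskerLeft (B := B) f η
  whiskerRight η h := Bicategory.whiskerRight (B := B) η h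
  associator f g h := isoMk (Bicategory.associator (B := B) f g h)
  leftUnitor f := isoMk (Bicategory.leftUnitor (B := B) f)
  rightUnitor f := isoMk (Bicategory.rightUnitor (B := B) f)
  whiskerLeft_id _ _ := Bicategory.whiskerLeft_id (B := B) _ _
  whiskerLeft_comp _ _ _ _ _ _ := Bicategory.whiskerLeft_comp (B := B) _ _ _
  id_whiskerLeft {a b} _ _ η :=
    (Bicategory.id_whiskerLeft (B := B) η).trans
      (Category.assoc (obj := (a.un ⟶ b.un)) _ _ _).symm
  comp_whiskerLeft {a _ _ d} f g _ _ η :=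
    (Bicategory.comp_whiskerLeft (B := B) f g η).trans
      (Category.assoc (obj := (a.un ⟶ d.un)) _ _ _).symm
  id_whiskerRight _ _ := Bicategory.id_whiskerRight (B := B) _ _
  comp_whiskerRight _ _ _ := Bicategory.comp_whiskerRight (B := B) _ _ _
  whiskerRight_id {a b} _ _ η :=
    (Bicategory.whiskerRight_id (B := B) η).trans
      (Category.assoc (obj := (a.un ⟶ b.un)) _ _ _).symm
  whiskerRight_comp {a _ _ d} _ _ η g h :=
    (Bicategory.whiskerRight_comp (B := B) η g h).trans
      (Category.assoc (obj := (a.un ⟶ d.un)) _ _ _).symm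
  whisker_assoc {a _ _ d} f _ _ η h :=
    (Bicategory.whisker_assoc (B := B) f η h).trans
      (Category.assoc (obj := (a.un ⟶ d.un)) _ _ _).symm
  whisker_exchange η θ := (Bicategory.whisker_exchange (B := B) η θ).symm
  pentagon {a _ _ _ e} f g h i :=
    Eq.trans (Category.assoc (obj := (a.un ⟶ e.un)) _ _ _)
      (Bicategory.pentagon_inv (B := B) f g h i)
  triangle f g := Bicategory.triangle_assoc_comp_left_inv (B := B) f g

variable {B}

theorem isoMk_eqToIso {a b : Co B} {f g : a ⟶ b} (e : @Iso (a.un ⟶ b.un) _ f g)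
    (h : f = g) (he : e = @eqToIso (a.un ⟶ b.un) _ f g h) : isoMk e = eqToIso h := by
  subst h; subst he; rfl

variable (B)

instance strict [Bicategory.Strict B] : Bicategory.Strict (Co B) where
  id_comp _ := Strict.id_comp (B := B) _
  comp_id _ := Strict.comp_id (B := B) _
  assoc _ _ _ := Strict.assoc (B := B) _ _ _
  leftUnitor_eqToIso _ := isoMk_eqToIso _ _ (Strict.leftUnitor_eqToIso (B := B) _)
  rightUnitor_eqToIso _ := isoMk_eqToIso _ _ (Strict.rightUnitor_eqToIso (B := B) _)
  associator_eqToIso _ _ _ := isoMk_eqToIso _ _ (Strict.associator_eqToIso (B := B) _ _ _)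

variable {B} {C : Type u₂} [Bicategory.{w₂, v₂} C]

theorem eqToHom_conj {a b : Co C} {f g f' g' : a ⟶ b} (h₁ : f = f') (α : f' ⟶ g') (h₂ : g' = g) :
    eqToHom h₁ ≫ α ≫ eqToHom h₂ =
      @CategoryStruct.comp (a.un ⟶ b.un) _ g g' f (eqToHom h₂.symm)
        (@CategoryStruct.comp (a.un ⟶ b.un) _ g' f' f α (eqToHom h₁.symm)) := by
  subst h₁ h₂
  exact ((Category.id_comp _).trans (Category.comp_id α)).trans
    ((Category.id_comp (obj := (a.un ⟶ b.un)) _).trans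
      (Category.comp_id (obj := (a.un ⟶ b.un)) _)).symm

/-- A 2-functor acts on the duals in the same way. -/
def functor [Bicategory.Strict B] [Bicategory.Strict C] (F : StrictPseudofunctor B C) :
    StrictPseudofunctor (Co B) (Co C) :=
  StrictPseudofunctor.mk'' (B := Co B) (C := Co C)
    { obj := fun a => F.obj a.un
      map := fun {a b} f => F.map (X := a.un) (Y := b.un) f
      map₂ := fun η => F.map₂ η
      map₂_id := fun _ => F.map₂_id _
      map₂_comp := fun _ _ => F.map₂_comp _ _
      map_id := fun _ => F.map_id _
      map_comp := fun _ _ => F.map_comp _ _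
      map₂_whisker_left := fun f _ _ η =>
        (strictPseudofunctor_whiskerLeft F f η).trans (eqToHom_conj (C := C) _ _ _).symm
      map₂_whisker_right := fun η g =>
        (strictPseudofunctor_whiskerRight F η g).trans (eqToHom_conj (C := C) _ _ _).symm }

end Co

/-- The dual of an F-category: 2-cells are reversed, tight 1-cells are the same. -/
def FCat.co (A : FCat.{w, v, u}) : FCat.{w, v, u} where
  toTwoCat := { obj := Co A.obj }
  Tight {a b} f := A.Tight (a := Co.un a) (b := Co.un b) f
  tight_id a := A.tight_id (Co.un a)
  tight_comp {a b c} f g hf hg :=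
    A.tight_comp (a := Co.un a) (b := Co.un b) (c := Co.un c) f g hf hg

/-- The dual of an F-functor, with the same action on objects, 1-cells and 2-cells. -/
def FFunctor.co {A B : FCat.{w, v, u}} (H : FFunctor A B) : FFunctor A.co B.co where
  toStrictPseudofunctor := Co.functor (B := A.obj) (C := B.obj) H.toStrictPseudofunctor
  map_tight {a b} f hf := H.map_tight (a := Co.un a) (b := Co.un b) f hf

/-! ### Limits of loose 1-cells -/

/-- A colax cone `(fst, cell, snd)` with base `X` over a loose 1-cell `f : a ⟶ b`. -/
structure ColaxCone {A : FCat.{w, v, u}} {a b : A.obj} (f : a ⟶ b) (X : A.obj) where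
  fst : X ⟶ a
  snd : X ⟶ b
  cell : snd ⟶ fst ≫ f

namespace ColaxCone

variable {A : FCat.{w, v, u}} {a b : A.obj} {f : a ⟶ b}

/-- The colax cone with base `X` obtained by precomposition with a 1-cell `t : X ⟶ Y`. -/
def precomp {X Y : A.obj} (t : X ⟶ Y) (c : ColaxCone f Y) : ColaxCone f X where
  fst := t ≫ c.fst
  snd := t ≫ c.snd
  cell := t ◁ c.cell ≫ (α_ t c.fst f).inv

/-- The colax cone `L` is universal among the colax cones which satisfy `P`, in the F-categorical
sense: it satisfies `P`; the projections are tight; each such cone factors uniquely through it; it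
has the two-dimensional universal property; the projections jointly detect tightness. -/
structure IsUniversal {C : A.obj} (L : ColaxCone f C)
    (P : ∀ {X : A.obj}, ColaxCone f X → Prop) : Prop where
  prop : P L
  tight_fst : A.Tight L.fst
  tight_snd : A.Tight L.snd
  existsUnique_lift : ∀ {X : A.obj} (c : ColaxCone f X), P c → ∃! t : X ⟶ C, precomp t L = c
  existsUnique_lift₂ : ∀ {X : A.obj} (c c' : ColaxCone f X), P c → P c' →
    ∀ (t t' : X ⟶ C), precomp t L = c → precomp t' L = c' →
      ∀ (θ₁ : c.fst ⟶ c'.fst) (θ₂ : c.snd ⟶ c'.snd), c.cell ≫ θ₁ ▷ f = θ₂ ≫ c'.cell →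
      ∃! φ : t ⟶ t', SameCell (φ ▷ L.fst) θ₁ ∧ SameCell (φ ▷ L.snd) θ₂
  tight_iff : ∀ {X : A.obj} (t : X ⟶ C),
    A.Tight t ↔ A.Tight (t ≫ L.fst) ∧ A.Tight (t ≫ L.snd)

end ColaxCone

/-- The three kinds of weakness: lax, pseudo and colax. -/
inductive Weakness
  | l
  | p
  | c

/-- The involution exchanging lax and colax. -/
def Weakness.bar : Weakness → Weakness
  | .l => .c
  | .p => .p
  | .c => .l

/-- Every loose 1-cell has a colax limit. -/
def FCat.HasColaxLimits (A : FCat.{w, v, u}) : Prop :=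
  ∀ {a b : A.obj} (f : a ⟶ b), ∃ (C : A.obj) (L : ColaxCone f C), L.IsUniversal (fun _ => True)

/-- Every loose 1-cell has a pseudolimit: a universal cone among those whose 2-cell is
invertible. -/
def FCat.HasPseudoLimits (A : FCat.{w, v, u}) : Prop :=
  ∀ {a b : A.obj} (f : a ⟶ b), ∃ (C : A.obj) (L : ColaxCone f C),
    L.IsUniversal (fun c => IsIso c.cell)

/-- The F-category has `w`-limits of loose 1-cells, that is lax limits, pseudolimits or colax
limits.  A lax limit is a colax limit in the dual. -/
def FCat.HasLimits (A : FCat.{w, v, u}) : Weakness → Prop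
  | .l => A.co.HasColaxLimits
  | .p => A.HasPseudoLimits
  | .c => A.HasColaxLimits

/-! ### Reflections and doctrinal F-functors -/

/-- An `l`-reflection: an adjunction with tight left adjoint `f` and identity counit. -/
@[ext]
structure LReflection {A : FCat.{w, v, u}} {a b : A.obj} (f : a ⟶ b) where
  tight : A.Tight f
  right : b ⟶ a
  adj : Bicategory.Adjunction f right
  counit_id : SameCell adj.counit (𝟙 (𝟙 b))

namespace LReflection

variable {A B : FCat.{w, v, u}}

/-- A `p`-reflection is an `l`-reflection with invertible unit. -/
def IsPseudo {a b : A.obj} {f : a ⟶ b} (R : LReflection f) : Prop :=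
  IsIso R.adj.unit

/-- The image of an `l`-reflection under an F-functor. -/
def map (H : FFunctor A B) {a b : A.obj} {f : a ⟶ b} (R : LReflection f) :
    LReflection (A := B) (H.map f) where
  tight := H.map_tight f R.tight
  right := H.map R.right
  adj := H.toStrictPseudofunctor.mapAdjunction R.adj
  counit_id := by
    obtain ⟨h₁, h₂, h⟩ := R.counit_id
    refine ⟨by rw [← H.map_comp, h₁, H.map_id], rfl, ?_⟩
    have h' : R.adj.counit = eqToHom h₁ := by simpa using h.symm
    rw [StrictPseudofunctor.mapAdjunction_counit', h']
    simp [PrelaxFunctor.map₂_eqToHom]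

/-- A tight commuting square `(r, s) : f₁ ⟶ f₂` is a morphism of `l`-reflections (or of
`p`-reflections) if the square of right adjoints commutes and it is compatible with the units. -/
def IsMorphism {a b a' b' : A.obj} {f₁ : a ⟶ b} {f₂ : a' ⟶ b'} (R₁ : LReflection f₁)
    (R₂ : LReflection f₂) (r : a ⟶ a') (s : b ⟶ b') : Prop :=
  R₁.right ≫ r = s ≫ R₂.right ∧ SameCell (R₁.adj.unit ▷ r) (r ◁ R₂.adj.unit)

end LReflection

namespace FFunctor

variable {A B : FCat.{w, v, u}}

/-- The F-functor reflects equality of parallel 2-cells. -/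
def LocallyFaithful (H : FFunctor A B) : Prop :=
  ∀ {a b : A.obj} {f g : a ⟶ b} (α β : f ⟶ g), H.map₂ α = H.map₂ β → α = β

/-- Reflections in the family `P` of `l`-reflections lift uniquely along `H`: given a tight `f`,
each reflection on `H f` in the family is the image of a unique reflection on `f` in the
family. -/
def Refl (P : ∀ {D : FCat.{w, v, u}} {a b : D.obj} {f : a ⟶ b}, LReflection f → Prop)
    (H : FFunctor A B) : Prop :=
  ∀ {a b : A.obj} (f : a ⟶ b), A.Tight f → ∀ R : LReflection (A := B) (H.map f), P R →
    ∃! R' : LReflection f, P R' ∧ R'.map H = R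

/-- A tight commuting square between reflections in the family `P` is a morphism of reflections
just when its image under `H` is one. -/
def Morph (P : ∀ {D : FCat.{w, v, u}} {a b : D.obj} {f : a ⟶ b}, LReflection f → Prop)
    (H : FFunctor A B) : Prop :=
  ∀ {a b a' b' : A.obj} {f₁ : a ⟶ b} {f₂ : a' ⟶ b'} (R₁ : LReflection f₁) (R₂ : LReflection f₂),
    P R₁ → P R₂ → ∀ (r : a ⟶ a') (s : b ⟶ b'), A.Tight r → A.Tight s → r ≫ f₂ = f₁ ≫ s →
      (R₁.IsMorphism R₂ r s ↔ (R₁.map H).IsMorphism (R₂.map H) (H.map r) (H.map s))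

/-- The condition `w`-Refl. -/
def WRefl : Weakness → FFunctor A B → Prop
  | .l, H => H.Refl (fun _ => True)
  | .p, H => H.Refl LReflection.IsPseudo
  | .c, H => H.co.Refl (fun _ => True)

/-- The condition `w`-Morph. -/
def WMorph : Weakness → FFunctor A B → Prop
  | .l, H => H.Morph (fun _ => True)
  | .p, H => H.Morph LReflection.IsPseudo
  | .c, H => H.co.Morph (fun _ => True)

end FFunctor

/-- The class `w`-Doct of `w`-doctrinal F-functors. -/
def wDoct (k : Weakness) : MorphismProperty FCat.{w, v, u} :=
  fun _ _ H => FFunctor.WRefl k H ∧ FFunctor.WMorph k H ∧ FFunctor.LocallyFaithful H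

/-! ### Orthogonality -/

/-- The morphism `e` is orthogonal to `m`: each commuting square from `e` to `m` has a unique
diagonal filler. -/
def Orthogonal {C : Type u} [Category.{v} C] {X Y Z W : C} (e : X ⟶ Y) (m : Z ⟶ W) : Prop :=
  ∀ (r : X ⟶ Z) (s : Y ⟶ W), r ≫ m = e ≫ s → ∃! k : Y ⟶ Z, e ≫ k = r ∧ k ≫ m = s

/-- The class `⊥M` of the morphisms which are orthogonal to all morphisms in `M`. -/
def leftOrthogonal {C : Type u} [Category.{v} C] (M : MorphismProperty C) : MorphismProperty C :=
  fun _ _ e => ∀ {Z W : C} (m : Z ⟶ W), M m → Orthogonal e m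

/-- The pair `(e, m)` is an orthogonal `(E, M)`-decomposition of `f`: `f = m ∘ e` with `e` in `E`
and `m` in `M`, where each morphism in `E` is orthogonal to each morphism in `M`. -/
structure IsOrthogonalDecomposition {C : Type u} [Category.{v} C] (E M : MorphismProperty C)
    {X Y Z : C} (f : X ⟶ Z) (e : X ⟶ Y) (m : Y ⟶ Z) : Prop where
  fac : e ≫ m = f
  left_mem : E e
  right_mem : M m
  orthogonal : ∀ {X' Y' Z' W' : C} (e' : X' ⟶ Y') (m' : Z' ⟶ W'), E e' → M m' → Orthogonal e' m'

/-! The content is that `j` is orthogonal to every doctrinal `m : Z ⟶ W`. Given that, the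
factorisation holds by definition and `H` lies in the right class by hypothesis.

Take `w = l`, or `w = p` with invertible cells throughout. Let `f : a ⟶ b` be loose with limit `C`,
tight projections `p`, `q` and universal 2-cell `λ : q ⟶ p ≫ f`. The identity cone on `f` induces a
section `t` of `p` with `t ≫ q = f`, and `λ` induces a unit making `p ⊣ t` a reflection
(`ColaxCone.IsUniversal.exists_reflection`). So every loose 1-cell is the right adjoint of a tight
reflection followed by a tight 1-cell.

For a square `(r, s)` from `j` to `m`, a filler must therefore send `f` to `t' ≫ r q`, where `t'` is
the right adjoint of `r p` lying over `s t`. Condition `w`-Refl says that `t'` exists and is unique,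
which gives uniqueness of the filler on 1-cells (`TightSquare.IsFiller.unique`). Condition `w`-Morph
shows that the value does not depend on the chosen factorisation of `f`
(`TightSquare.exists_value`), and functoriality follows. On 2-cells, local faithfulness gives
uniqueness and all equations, so it remains to lift each `s α` along `m`. The lift comes from an
invertible unit in the pseudo case and from the universal property of the limit in the other
(`exists_cell_of_iso`, `exists_cell_of_not_iso`). The case `w = c` is dual.

A proposition `ps` treats two cases at once: true for `p`, false for `l`. -/

/-! ### Calculus of 2-cells up to equality of their boundary -/

namespace SameCell

variable {B : Type u} [Bicategory.{w, v} B] {a b c d : B}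

theorem refl {f g : a ⟶ b} (α : f ⟶ g) : SameCell α α :=
  ⟨rfl, rfl, by simp⟩

theorem of_eq {f g : a ⟶ b} {α β : f ⟶ g} (h : α = β) : SameCell α β :=
  h ▸ refl α

theorem eq {f g : a ⟶ b} {α β : f ⟶ g} (h : SameCell α β) : α = β := by
  obtain ⟨_, _, h⟩ := h
  simpa using h.symm

theorem symm {f g f' g' : a ⟶ b} {α : f ⟶ g} {β : f' ⟶ g'} (h : SameCell α β) :
    SameCell β α := by
  obtain ⟨rfl, rfl, h⟩ := h
  exact ⟨rfl, rfl, by simpa using h.symm⟩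

theorem trans {f g f' g' f'' g'' : a ⟶ b} {α : f ⟶ g} {β : f' ⟶ g'} {γ : f'' ⟶ g''}
    (h : SameCell α β) (h' : SameCell β γ) : SameCell α γ := by
  obtain ⟨rfl, rfl, h⟩ := h
  obtain rfl := (SameCell.eq ⟨rfl, rfl, h⟩ : α = β)
  exact h'

/-- Induction principle: the same 2-cells satisfy the same properties. -/
theorem rec_on {f g : a ⟶ b} {α : f ⟶ g} {p : ∀ {f' g' : a ⟶ b}, (f' ⟶ g') → Prop}
    {f' g' : a ⟶ b} {β : f' ⟶ g'} (h : SameCell α β) (h' : p α) : p β := by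
  obtain ⟨rfl, rfl, h⟩ := h
  obtain rfl := (SameCell.eq ⟨rfl, rfl, h⟩ : α = β)
  exact h'

theorem comp {f g h f' g' h' : a ⟶ b} {α : f ⟶ g} {α' : f' ⟶ g'} {β : g ⟶ h} {β' : g' ⟶ h'}
    (hα : SameCell α α') (hβ : SameCell β β') : SameCell (α ≫ β) (α' ≫ β') := by
  obtain ⟨rfl, rfl, hα⟩ := hα
  obtain ⟨_, rfl, hβ⟩ := hβ
  exact ⟨rfl, rfl, by simp at hα hβ ⊢; rw [hα, hβ]⟩

theorem whiskerLeft {f f' : a ⟶ b} (hf : f = f') {g h g' h' : b ⟶ c} {α : g ⟶ h} {β : g' ⟶ h'}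
    (H : SameCell α β) : SameCell (f ◁ α) (f' ◁ β) := by
  subst hf
  exact H.rec_on (p := fun x => SameCell (f ◁ α) (f ◁ x)) (refl _)

theorem whiskerRight {g h g' h' : a ⟶ b} {α : g ⟶ h} {β : g' ⟶ h'} (H : SameCell α β)
    {f f' : b ⟶ c} (hf : f = f') : SameCell (α ▷ f) (β ▷ f') := by
  subst hf
  exact H.rec_on (p := fun x => SameCell (α ▷ f) (x ▷ f)) (refl _)

theorem eqToHom_id {f g : a ⟶ b} (h : f = g) : SameCell (eqToHom h) (𝟙 f) := by
  subst h; exact refl _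

theorem eqToHom_id' {f g : a ⟶ b} (h : f = g) : SameCell (eqToHom h) (𝟙 g) := by
  subst h; exact refl _

theorem id_congr {f g : a ⟶ b} (h : f = g) : SameCell (𝟙 f) (𝟙 g) := by
  subst h; exact refl _

theorem eq_eqToHom {f g k : a ⟶ b} {α : f ⟶ g} (h : SameCell α (𝟙 k)) :
    ∃ e : f = g, α = eqToHom e := by
  obtain ⟨rfl, rfl, h⟩ := h
  exact ⟨rfl, by simpa using h.symm⟩

/-- Factors that are identities up to their boundary can be dropped from a composite. The free `k`
spares any transport along equations between 1-cells. -/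
theorem id_comp {f g h k : a ⟶ b} {α : f ⟶ g} (hα : SameCell α (𝟙 k)) (β : g ⟶ h) :
    SameCell (α ≫ β) β := by
  obtain ⟨rfl, rfl⟩ := hα.eq_eqToHom
  simpa using refl β

theorem comp_id {f g h k : a ⟶ b} (β : f ⟶ g) {α : g ⟶ h} (hα : SameCell α (𝟙 k)) :
    SameCell (β ≫ α) β := by
  obtain ⟨rfl, rfl⟩ := hα.eq_eqToHom
  simpa using refl β

theorem eqToHom_comp {f g h : a ⟶ b} (e : f = g) (β : g ⟶ h) :
    SameCell (eqToHom e ≫ β) β :=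
  id_comp (eqToHom_id e) β

theorem comp_eqToHom {f g h : a ⟶ b} (β : f ⟶ g) (e : g = h) :
    SameCell (β ≫ eqToHom e) β :=
  comp_id β (eqToHom_id e)

theorem whiskerLeft_id (f : a ⟶ b) {g h k : b ⟶ c} {α : g ⟶ h} (hα : SameCell α (𝟙 k)) :
    SameCell (f ◁ α) (𝟙 (f ≫ k)) :=
  (whiskerLeft rfl hα).trans (by simpa using refl _)

theorem id_whiskerRight {g h k : a ⟶ b} {α : g ⟶ h} (hα : SameCell α (𝟙 k)) (f : b ⟶ c) :
    SameCell (α ▷ f) (𝟙 (k ≫ f)) :=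
  (whiskerRight hα rfl).trans (by simpa using refl _)

theorem isIso {f g f' g' : a ⟶ b} {α : f ⟶ g} {β : f' ⟶ g'} (h : SameCell α β) (hα : IsIso α) :
    IsIso β :=
  h.rec_on (p := fun x => IsIso x) hα

/-- Needed only at the end, where fillers are compared as F-functors and equality of their actions
is heterogeneous. -/
theorem iff_heq {f g f' g' : a ⟶ b} {α : f ⟶ g} {β : f' ⟶ g'} :
    SameCell α β ↔ f = f' ∧ g = g' ∧ HEq α β := by
  constructor
  · intro h
    exact h.rec_on (p := fun {f' g'} x => f = f' ∧ g = g' ∧ HEq α x) ⟨rfl, rfl, HEq.rfl⟩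
  · rintro ⟨rfl, rfl, h⟩
    rw [eq_of_heq h]
    exact refl _

variable [Strict B]

theorem id_whiskerLeft {f g : a ⟶ b} (η : f ⟶ g) : SameCell (𝟙 a ◁ η) η := by
  rw [Bicategory.id_whiskerLeft, Strict.leftUnitor_eqToIso, Strict.leftUnitor_eqToIso,
    eqToIso.hom, eqToIso.inv]
  exact (eqToHom_comp _ _).trans (comp_eqToHom _ _)

theorem whiskerRight_one {f g : a ⟶ b} (η : f ⟶ g) : SameCell (η ▷ 𝟙 b) η := by
  rw [Bicategory.whiskerRight_id, Strict.rightUnitor_eqToIso, Strict.rightUnitor_eqToIso,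
    eqToIso.hom, eqToIso.inv]
  exact (eqToHom_comp _ _).trans (comp_eqToHom _ _)

theorem comp_whiskerLeft (f : a ⟶ b) (g : b ⟶ c) {h h' : c ⟶ d} (η : h ⟶ h') :
    SameCell ((f ≫ g) ◁ η) (f ◁ g ◁ η) := by
  rw [Bicategory.comp_whiskerLeft, Strict.associator_eqToIso, Strict.associator_eqToIso,
    eqToIso.hom, eqToIso.inv]
  exact (eqToHom_comp _ _).trans (comp_eqToHom _ _)

theorem whiskerRight_comp {f f' : a ⟶ b} (η : f ⟶ f') (g : b ⟶ c) (h : c ⟶ d) :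
    SameCell (η ▷ (g ≫ h)) (η ▷ g ▷ h) := by
  rw [Bicategory.whiskerRight_comp, Strict.associator_eqToIso, Strict.associator_eqToIso,
    eqToIso.hom, eqToIso.inv]
  exact (eqToHom_comp _ _).trans (comp_eqToHom _ _)

theorem whisker_assoc (f : a ⟶ b) {g g' : b ⟶ c} (η : g ⟶ g') (h : c ⟶ d) :
    SameCell ((f ◁ η) ▷ h) (f ◁ η ▷ h) := by
  rw [Bicategory.whisker_assoc, Strict.associator_eqToIso, Strict.associator_eqToIso,
    eqToIso.hom, eqToIso.inv]
  exact (eqToHom_comp _ _).trans (comp_eqToHom _ _)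

end SameCell

/-! ### Reflections described by their units -/

/-- The 2-cell `η` exhibits `g` as right adjoint to `f` with identity counit. -/
structure IsReflectionUnit {B : Type u} [Bicategory.{w, v} B] {a b : B} (f : a ⟶ b) (g : b ⟶ a)
    (η : 𝟙 a ⟶ f ≫ g) : Prop where
  comp_eq : g ≫ f = 𝟙 b
  left : SameCell (η ▷ f) (𝟙 f)
  right : SameCell (g ◁ η) (𝟙 g)

namespace IsReflectionUnit

variable {B : Type u} [Bicategory.{w, v} B] [Strict B] {a b c : B}

theorem id (a : B) : IsReflectionUnit (𝟙 a) (𝟙 a) (eqToHom (Strict.id_comp (𝟙 a)).symm) where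
  comp_eq := Strict.id_comp _
  left := (SameCell.whiskerRight_one _).trans (SameCell.eqToHom_id _)
  right := (SameCell.id_whiskerLeft _).trans (SameCell.eqToHom_id _)

/-- Interchange writes the horizontal composite of `η'` and `η` in two ways. In one, `η' ▷ f` is an
identity and `η` remains; in the other, `g ◁ η` is an identity and `η'` remains. -/
theorem unit_unique {f : a ⟶ b} {g : b ⟶ a} {η η' : 𝟙 a ⟶ f ≫ g} (h : IsReflectionUnit f g η)
    (h' : IsReflectionUnit f g η') : η = η' := by
  have e := Bicategory.whisker_exchange η' η
  have h₁ : SameCell (𝟙 a ◁ η ≫ η' ▷ (f ≫ g)) η :=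
    (SameCell.comp_id _ ((SameCell.whiskerRight_comp _ _ _).trans
      (SameCell.id_whiskerRight h'.left g))).trans (SameCell.id_whiskerLeft η)
  have h₂ : SameCell (η' ▷ 𝟙 a ≫ (f ≫ g) ◁ η) η' :=
    (SameCell.comp_id _ ((SameCell.comp_whiskerLeft _ _ _).trans
      (SameCell.whiskerLeft_id f h.right))).trans (SameCell.whiskerRight_one η')
  exact (h₁.symm.trans (e ▸ h₂)).eq

/-- The unit of a composite of reflections. -/
def compUnit {f : a ⟶ b} {g : b ⟶ a} (η : 𝟙 a ⟶ f ≫ g) {f' : b ⟶ c} {g' : c ⟶ b}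
    (η' : 𝟙 b ⟶ f' ≫ g') : 𝟙 a ⟶ (f ≫ f') ≫ g' ≫ g :=
  η ≫ eqToHom (by rw [Strict.id_comp]) ≫ f ◁ η' ▷ g ≫ eqToHom (by simp only [Strict.assoc])

theorem compUnit_same {f : a ⟶ b} {g : b ⟶ a} (η : 𝟙 a ⟶ f ≫ g) {f' : b ⟶ c} {g' : c ⟶ b}
    (η' : 𝟙 b ⟶ f' ≫ g') :
    SameCell (compUnit η η') ((η ≫ eqToHom (by rw [Strict.id_comp])) ≫ f ◁ η' ▷ g) := by
  refine SameCell.trans ?_ (SameCell.of_eq (Category.assoc _ _ _)).symm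
  exact (SameCell.refl _).comp ((SameCell.refl _).comp (SameCell.comp_eqToHom _ _))

theorem comp {f : a ⟶ b} {g : b ⟶ a} {η : 𝟙 a ⟶ f ≫ g} {f' : b ⟶ c} {g' : c ⟶ b}
    {η' : 𝟙 b ⟶ f' ≫ g'} (h : IsReflectionUnit f g η) (h' : IsReflectionUnit f' g' η') :
    IsReflectionUnit (f ≫ f') (g' ≫ g) (compUnit η η') where
  comp_eq := by
    rw [Strict.assoc, ← Strict.assoc g, h.comp_eq, Strict.id_comp, h'.comp_eq]
  left := by
    refine (SameCell.whiskerRight (compUnit_same η η') rfl).trans ?_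
    rw [Bicategory.comp_whiskerRight]
    have h₁ : SameCell ((η ≫ eqToHom (by rw [Strict.id_comp] : f ≫ g = f ≫ 𝟙 b ≫ g)) ▷ (f ≫ f'))
        (𝟙 (f ≫ f')) :=
      (SameCell.whiskerRight (SameCell.comp_eqToHom _ _) rfl).trans
        ((SameCell.whiskerRight_comp _ _ _).trans (SameCell.id_whiskerRight h.left f'))
    refine (SameCell.id_comp h₁ _).trans ?_
    refine (SameCell.whisker_assoc _ _ _).trans ?_
    -- Since `g ≫ f = 𝟙 b`, whiskering with `g ≫ f ≫ f'` is whiskering with `f'`.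
    have h₂ : SameCell (η' ▷ g ▷ (f ≫ f')) (𝟙 f') :=
      (SameCell.whiskerRight_comp _ _ _).symm.trans
        ((SameCell.whiskerRight (SameCell.refl η')
          (by rw [← Strict.assoc, h.comp_eq, Strict.id_comp])).trans h'.left)
    exact SameCell.whiskerLeft_id f h₂
  right := by
    refine (SameCell.whiskerLeft rfl (compUnit_same η η')).trans ?_
    rw [Bicategory.whiskerLeft_comp]
    have h₁ : SameCell ((g' ≫ g) ◁ (η ≫ eqToHom (by rw [Strict.id_comp] : f ≫ g = f ≫ 𝟙 b ≫ g)))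
        (𝟙 (g' ≫ g)) :=
      (SameCell.whiskerLeft rfl (SameCell.comp_eqToHom _ _)).trans
        ((SameCell.comp_whiskerLeft _ _ _).trans (SameCell.whiskerLeft_id g' h.right))
    refine (SameCell.id_comp h₁ _).trans ?_
    refine (SameCell.comp_whiskerLeft _ _ _).symm.trans ?_
    refine (SameCell.whiskerLeft (by rw [Strict.assoc, h.comp_eq, Strict.comp_id])
      (SameCell.refl _)).trans ?_
    exact (SameCell.whisker_assoc _ _ _).symm.trans (SameCell.id_whiskerRight h'.right g)

/-- A square between reflections whose right adjoints commute is compatible with the units. -/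
theorem unit_compatible {a' b' : B} {f₁ : a ⟶ b} {g₁ : b ⟶ a} {η₁ : 𝟙 a ⟶ f₁ ≫ g₁} {f₂ : a' ⟶ b'}
    {g₂ : b' ⟶ a'} {η₂ : 𝟙 a' ⟶ f₂ ≫ g₂} (h₁ : IsReflectionUnit f₁ g₁ η₁)
    (h₂ : IsReflectionUnit f₂ g₂ η₂) {r : a ⟶ a'} {s : b ⟶ b'} (hrs : r ≫ f₂ = f₁ ≫ s)
    (hg : g₁ ≫ r = s ≫ g₂) : SameCell (η₁ ▷ r) (r ◁ η₂) := by
  -- Of the two sides of this interchange, one loses `η₁` because `r ≫ f₂ = f₁ ≫ s` and `η₁ ▷ f₁` is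
  -- an identity. The other loses `η₂` because `g₁ ≫ r = s ≫ g₂` and `g₂ ◁ η₂` is an identity.
  have e := Bicategory.whisker_exchange η₁ (r ◁ η₂)
  have e₁ : SameCell (𝟙 a ◁ r ◁ η₂ ≫ η₁ ▷ (r ≫ f₂ ≫ g₂)) (r ◁ η₂) := by
    refine (SameCell.comp_id (k := f₁ ≫ s ≫ g₂) _ ?_).trans (SameCell.id_whiskerLeft _)
    exact ((SameCell.refl η₁).whiskerRight (by rw [← Strict.assoc, hrs, Strict.assoc])).trans
      ((SameCell.whiskerRight_comp _ _ _).trans (SameCell.id_whiskerRight h₁.left _))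
  have e₂ : SameCell (η₁ ▷ (r ≫ 𝟙 a') ≫ (f₁ ≫ g₁) ◁ r ◁ η₂) (η₁ ▷ r) := by
    refine (SameCell.comp_id (k := f₁ ≫ s ≫ g₂) _ ?_).trans
      ((SameCell.refl η₁).whiskerRight (Strict.comp_id r))
    refine (SameCell.comp_whiskerLeft _ _ _).trans (SameCell.whiskerLeft_id f₁ ?_)
    refine (SameCell.comp_whiskerLeft _ _ _).symm.trans ?_
    exact (SameCell.whiskerLeft hg (SameCell.refl η₂)).trans
      ((SameCell.comp_whiskerLeft _ _ _).trans (SameCell.whiskerLeft_id s h₂.right))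
  exact (e₁.symm.trans (e ▸ e₂)).symm

end IsReflectionUnit

/-- The 1-cell `g` is right adjoint to `f` with identity counit, and with invertible unit
if `ps` holds. -/
def IsReflection (ps : Prop) {B : Type u} [Bicategory.{w, v} B] {a b : B} (f : a ⟶ b)
    (g : b ⟶ a) : Prop :=
  ∃ η, IsReflectionUnit f g η ∧ (ps → IsIso η)

namespace IsReflection

variable {ps : Prop} {B : Type u} [Bicategory.{w, v} B] [Strict B] {a b c : B}

theorem id (a : B) : IsReflection ps (𝟙 a) (𝟙 a) :=
  ⟨_, IsReflectionUnit.id a, fun _ => inferInstance⟩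

theorem comp {f : a ⟶ b} {g : b ⟶ a} {f' : b ⟶ c} {g' : c ⟶ b} (h : IsReflection ps f g)
    (h' : IsReflection ps f' g') : IsReflection ps (f ≫ f') (g' ≫ g) := by
  obtain ⟨η, h, hi⟩ := h
  obtain ⟨η', h', hi'⟩ := h'
  refine ⟨_, h.comp h', fun hp => ?_⟩
  have := hi hp
  have := hi' hp
  unfold IsReflectionUnit.compUnit
  infer_instance

end IsReflection

/-! ### Comparison with `l`-reflections -/

theorem leftZigzag_same {B : Type u} [Bicategory.{w, v} B] [Strict B] {a b : B} {f : a ⟶ b}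
    {g : b ⟶ a} (η : 𝟙 a ⟶ f ≫ g) {ζ : g ≫ f ⟶ 𝟙 b} {k : b ⟶ b} (hζ : SameCell ζ (𝟙 k)) :
    SameCell (leftZigzag η ζ) (η ▷ f) := by
  rw [leftZigzag, bicategoricalComp]
  refine SameCell.comp_id (k := f ≫ k) _ ?_
  refine (SameCell.id_comp (k := f ≫ g ≫ f) ?_ _).trans (SameCell.whiskerLeft_id f hζ)
  simp [BicategoricalCoherence.iso, Strict.associator_eqToIso]
  exact SameCell.eqToHom_id' _

theorem rightZigzag_same {B : Type u} [Bicategory.{w, v} B] [Strict B] {a b : B} {f : a ⟶ b}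
    {g : b ⟶ a} (η : 𝟙 a ⟶ f ≫ g) {ζ : g ≫ f ⟶ 𝟙 b} {k : b ⟶ b} (hζ : SameCell ζ (𝟙 k)) :
    SameCell (rightZigzag η ζ) (g ◁ η) := by
  rw [rightZigzag, bicategoricalComp]
  refine SameCell.comp_id (k := k ≫ g) _ ?_
  refine (SameCell.id_comp (k := g ≫ f ≫ g) ?_ _).trans (SameCell.id_whiskerRight hζ g)
  simp [BicategoricalCoherence.iso, Strict.associator_eqToIso]
  exact SameCell.eqToHom_id _

namespace LReflection

variable {A B : FCat.{w, v, u}} {a b : A.obj} {f : a ⟶ b}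

/-- When the counit is an identity, each zigzag collapses to a whiskering of the unit, so the
triangle identities say that these whiskerings are identities. -/
theorem isReflectionUnit (R : LReflection f) : IsReflectionUnit f R.right R.adj.unit where
  comp_eq := R.counit_id.1
  left := by
    refine (leftZigzag_same R.adj.unit R.counit_id).symm.trans ?_
    rw [R.adj.left_triangle, Strict.leftUnitor_eqToIso, Strict.rightUnitor_eqToIso, eqToIso.hom,
      eqToIso.inv, eqToHom_trans]
    exact (SameCell.eqToHom_id _).trans (SameCell.id_congr (Strict.id_comp f))
  right := by
    refine (rightZigzag_same R.adj.unit R.counit_id).symm.trans ?_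
    rw [R.adj.right_triangle, Strict.leftUnitor_eqToIso, Strict.rightUnitor_eqToIso, eqToIso.hom,
      eqToIso.inv, eqToHom_trans]
    exact (SameCell.eqToHom_id _).trans (SameCell.id_congr (Strict.comp_id _))

/-- An `l`-reflection is determined by the right adjoint. -/
theorem ext_right {R R' : LReflection f} (h : R.right = R'.right) : R = R' := by
  have hu := R.isReflectionUnit
  have hu' := R'.isReflectionUnit
  have hc := R.counit_id
  have hc' := R'.counit_id
  obtain ⟨_, g, adj, _⟩ := R
  obtain ⟨_, g', adj', _⟩ := R'
  dsimp only at h hu hu' hc hc'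
  subst h
  obtain rfl : adj = adj' := by
    ext
    · exact hu.unit_unique hu'
    · exact (hc.trans hc'.symm).eq
  rfl

/-- The `l`-reflection with a given unit. -/
def ofUnit (hf : A.Tight f) {g : b ⟶ a} {η : 𝟙 a ⟶ f ≫ g} (h : IsReflectionUnit f g η) :
    LReflection f where
  tight := hf
  right := g
  adj :=
    { unit := η
      counit := eqToHom h.comp_eq
      left_triangle := by
        refine ((leftZigzag_same η (SameCell.eqToHom_id _)).trans (h.left.trans ?_)).eq
        rw [Strict.leftUnitor_eqToIso, Strict.rightUnitor_eqToIso, eqToIso.hom, eqToIso.inv,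
          eqToHom_trans]
        exact ((SameCell.eqToHom_id _).trans (SameCell.id_congr (Strict.id_comp f))).symm
      right_triangle := by
        refine ((rightZigzag_same η (SameCell.eqToHom_id _)).trans (h.right.trans ?_)).eq
        rw [Strict.leftUnitor_eqToIso, Strict.rightUnitor_eqToIso, eqToIso.hom, eqToIso.inv,
          eqToHom_trans]
        exact ((SameCell.eqToHom_id _).trans (SameCell.id_congr (Strict.comp_id _))).symm }
  counit_id := SameCell.eqToHom_id' h.comp_eq

/-- The unit condition is automatic by `unit_compatible`, so only commutation of the right adjoints
matters. -/
theorem isMorphism_iff {a' b' : A.obj} {f' : a' ⟶ b'} (R : LReflection f) (R' : LReflection f')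
    {r : a ⟶ a'} {s : b ⟶ b'} (hrs : r ≫ f' = f ≫ s) :
    R.IsMorphism R' r s ↔ R.right ≫ r = s ≫ R'.right :=
  ⟨fun h => h.1, fun h =>
    ⟨h, R.isReflectionUnit.unit_compatible R'.isReflectionUnit hrs h⟩⟩

end LReflection

namespace FFunctor

variable {Z W : FCat.{w, v, u}}

/-- The form of `w`-Refl which speaks of right adjoints only. -/
def LiftsReflections (ps : Prop) (m : FFunctor Z W) : Prop :=
  ∀ {a b : Z.obj} (f : a ⟶ b), Z.Tight f → ∀ y : m.obj b ⟶ m.obj a,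
    IsReflection ps (m.map f) y → ∃! x : b ⟶ a, IsReflection ps f x ∧ m.map x = y

/-- The part of `w`-Morph which lifts morphisms, in terms of right adjoints only. -/
def LiftsReflectionMorphisms (ps : Prop) (m : FFunctor Z W) : Prop :=
  ∀ {a b a' b' : Z.obj} {f₁ : a ⟶ b} {f₂ : a' ⟶ b'}, Z.Tight f₁ → Z.Tight f₂ →
    ∀ {x₁ : b ⟶ a} {x₂ : b' ⟶ a'}, IsReflection ps f₁ x₁ → IsReflection ps f₂ x₂ →
    ∀ {r : a ⟶ a'} {s : b ⟶ b'}, Z.Tight r → Z.Tight s → r ≫ f₂ = f₁ ≫ s →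
      m.map x₁ ≫ m.map r = m.map s ≫ m.map x₂ → x₁ ≫ r = s ≫ x₂

/-- A reflection on a given 1-cell is determined by its right adjoint, so lifting reflections
uniquely amounts to lifting right adjoints uniquely. -/
theorem Refl.liftsReflections {ps : Prop}
    {P : ∀ {D : FCat.{w, v, u}} {a b : D.obj} {f : a ⟶ b}, LReflection f → Prop}
    {m : FFunctor Z W} (h : m.Refl P)
    (hP : ∀ {D : FCat.{w, v, u}} {a b : D.obj} {f : a ⟶ b} (R : LReflection f),
      P R ↔ (ps → IsIso R.adj.unit)) : m.LiftsReflections ps := by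
  rintro a b f hf y ⟨η, hη, hi⟩
  obtain ⟨R, ⟨hR, hR'⟩, huniq⟩ :=
    h f hf (LReflection.ofUnit (A := W) (m.map_tight f hf) hη) ((hP _).2 hi)
  refine ⟨R.right, ⟨⟨R.adj.unit, R.isReflectionUnit, (hP _).1 hR⟩,
    congrArg (fun R => LReflection.right R) hR'⟩, ?_⟩
  rintro x ⟨⟨θ, hθ, hi'⟩, hx⟩
  have := huniq (LReflection.ofUnit hf hθ) ⟨(hP _).2 hi', LReflection.ext_right (A := W) hx⟩
  exact congrArg (fun R => LReflection.right R) this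

theorem Morph.liftsReflectionMorphisms {ps : Prop}
    {P : ∀ {D : FCat.{w, v, u}} {a b : D.obj} {f : a ⟶ b}, LReflection f → Prop}
    {m : FFunctor Z W} (h : m.Morph P)
    (hP : ∀ {D : FCat.{w, v, u}} {a b : D.obj} {f : a ⟶ b} (R : LReflection f),
      P R ↔ (ps → IsIso R.adj.unit)) : m.LiftsReflectionMorphisms ps := by
  rintro a b a' b' f₁ f₂ hf₁ hf₂ x₁ x₂ ⟨η₁, hη₁, hi₁⟩ ⟨η₂, hη₂, hi₂⟩ r s hr hs hrs hm
  refine ((h (LReflection.ofUnit hf₁ hη₁) (LReflection.ofUnit hf₂ hη₂) ((hP _).2 hi₁)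
    ((hP _).2 hi₂) r s hr hs hrs).2
    ?_).1
  refine (LReflection.isMorphism_iff (A := W) _ _ ?_).2 hm
  rw [← m.map_comp, hrs, m.map_comp]

end FFunctor

/-! ### 2-functors with a given action on objects -/

/-- The action on 1-cells and 2-cells of a 2-functor with a given action on objects. -/
structure TwoFunctorOver {X : Type u₁} [Bicategory.{w₁, v₁} X] {Y : Type u₂}
    [Bicategory.{w₂, v₂} Y] (ρ : X → Y) where
  map : ∀ {a b : X}, (a ⟶ b) → (ρ a ⟶ ρ b)
  map₂ : ∀ {a b : X} {f g : a ⟶ b}, (f ⟶ g) → (map f ⟶ map g)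
  map_id : ∀ a : X, map (𝟙 a) = 𝟙 (ρ a)
  map_comp : ∀ {a b c : X} (f : a ⟶ b) (g : b ⟶ c), map (f ≫ g) = map f ≫ map g
  map₂_id : ∀ {a b : X} (f : a ⟶ b), map₂ (𝟙 f) = 𝟙 (map f)
  map₂_comp : ∀ {a b : X} {f g h : a ⟶ b} (α : f ⟶ g) (β : g ⟶ h),
    map₂ (α ≫ β) = map₂ α ≫ map₂ β
  map₂_whiskerLeft : ∀ {a b c : X} (f : a ⟶ b) {g h : b ⟶ c} (α : g ⟶ h),
    SameCell (map₂ (f ◁ α)) (map f ◁ map₂ α)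
  map₂_whiskerRight : ∀ {a b c : X} {f g : a ⟶ b} (α : f ⟶ g) (h : b ⟶ c),
    SameCell (map₂ (α ▷ h)) (map₂ α ▷ map h)

namespace TwoFunctorOver

variable {X : Type u₁} [Bicategory.{w₁, v₁} X] {Y : Type u₂} [Bicategory.{w₂, v₂} Y] {ρ : X → Y}

/-- The underlying action of a 2-functor. -/
def ofStrict (F : StrictPseudofunctor X Y) : TwoFunctorOver F.obj where
  map := F.map
  map₂ := F.map₂
  map_id := F.map_id
  map_comp := F.map_comp
  map₂_id := F.map₂_id
  map₂_comp := F.map₂_comp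
  map₂_whiskerLeft f _ _ α := by
    rw [strictPseudofunctor_whiskerLeft]
    exact (SameCell.eqToHom_comp _ _).trans (SameCell.comp_eqToHom _ _)
  map₂_whiskerRight α h := by
    rw [strictPseudofunctor_whiskerRight]
    exact (SameCell.eqToHom_comp _ _).trans (SameCell.comp_eqToHom _ _)

theorem _root_.SameCell.eq_conj {a b : Y} {f g f' g' : a ⟶ b} {α : f ⟶ g} {β : f' ⟶ g'}
    (h : SameCell α β) (hf : f = f') (hg : g' = g) : α = eqToHom hf ≫ β ≫ eqToHom hg :=
  (h.trans ((SameCell.eqToHom_comp _ _).trans (SameCell.comp_eqToHom _ _)).symm).eq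

/-- The 2-functor with a given action. -/
def toStrict [Strict X] [Strict Y] (K : TwoFunctorOver ρ) : StrictPseudofunctor X Y :=
  StrictPseudofunctor.mk''
    { obj := ρ
      map := K.map
      map₂ := K.map₂
      map₂_id := K.map₂_id
      map₂_comp := K.map₂_comp
      map_id := K.map_id
      map_comp := K.map_comp
      map₂_whisker_left := fun f _ _ η => (K.map₂_whiskerLeft f η).eq_conj _ _
      map₂_whisker_right := fun η g => (K.map₂_whiskerRight η g).eq_conj _ _ }

/-- Since `j` is the identity on objects, the action of a filler on objects is forced. Fixing it
once lets equations between 1-cells be stated without transport. -/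
theorem exists_toStrict_eq [Strict X] [Strict Y] (F : StrictPseudofunctor X Y) (h : F.obj = ρ) :
    ∃ K : TwoFunctorOver ρ, K.toStrict = F := by
  subst h
  exact ⟨ofStrict F, strictPseudofunctor_ext rfl⟩

variable (K : TwoFunctorOver ρ)

theorem map₂_same {a b : X} {f g f' g' : a ⟶ b} {α : f ⟶ g} {β : f' ⟶ g'} (h : SameCell α β) :
    SameCell (K.map₂ α) (K.map₂ β) :=
  h.rec_on (p := fun x => SameCell (K.map₂ α) (K.map₂ x)) (SameCell.refl _)

theorem map₂_id_same {a b : X} {f g k : a ⟶ b} {α : f ⟶ g} (h : SameCell α (𝟙 k)) :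
    SameCell (K.map₂ α) (𝟙 (K.map k)) :=
  K.map₂_id k ▸ K.map₂_same h

/-- The image of a unit, with source and target adjusted. -/
def mapUnit {a b : X} {f : a ⟶ b} {g : b ⟶ a} (η : 𝟙 a ⟶ f ≫ g) :
    𝟙 (ρ a) ⟶ K.map f ≫ K.map g :=
  eqToHom (K.map_id a).symm ≫ K.map₂ η ≫ eqToHom (K.map_comp f g)

theorem mapUnit_same {a b : X} {f : a ⟶ b} {g : b ⟶ a} (η : 𝟙 a ⟶ f ≫ g) :
    SameCell (K.mapUnit η) (K.map₂ η) :=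
  (SameCell.eqToHom_comp _ _).trans (SameCell.comp_eqToHom _ _)

theorem map_isReflectionUnit {a b : X} {f : a ⟶ b} {g : b ⟶ a} {η : 𝟙 a ⟶ f ≫ g}
    (h : IsReflectionUnit f g η) : IsReflectionUnit (K.map f) (K.map g) (K.mapUnit η) where
  comp_eq := by rw [← K.map_comp, h.comp_eq, K.map_id]
  left := ((K.mapUnit_same η).whiskerRight rfl).trans ((K.map₂_whiskerRight η f).symm.trans
    (K.map₂_id_same h.left))
  right := (SameCell.whiskerLeft rfl (K.mapUnit_same η)).trans
    ((K.map₂_whiskerLeft g η).symm.trans (K.map₂_id_same h.right))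

theorem map_isReflection {ps : Prop} {a b : X} {f : a ⟶ b} {g : b ⟶ a}
    (h : IsReflection ps f g) : IsReflection ps (K.map f) (K.map g) := by
  obtain ⟨η, h, hi⟩ := h
  refine ⟨_, K.map_isReflectionUnit h, fun hp => (K.mapUnit_same η).symm.isIso ?_⟩
  have := hi hp
  exact ⟨K.map₂ (inv η), by rw [← K.map₂_comp, IsIso.hom_inv_id, K.map₂_id],
    by rw [← K.map₂_comp, IsIso.inv_hom_id, K.map₂_id]⟩

theorem ext_same {K K' : TwoFunctorOver ρ} (h : ∀ {a b : X} (f : a ⟶ b), K.map f = K'.map f)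
    (h' : ∀ {a b : X} {f g : a ⟶ b} (α : f ⟶ g), SameCell (K.map₂ α) (K'.map₂ α)) : K = K' := by
  obtain ⟨k, k₂, _⟩ := K
  obtain ⟨k', k₂', _⟩ := K'
  dsimp only at h h'
  obtain rfl : @k = @k' := by
    funext a b f; exact h f
  obtain rfl : @k₂ = @k₂' := by
    funext a b f g α; exact (h' α).eq
  rfl

end TwoFunctorOver

/-! ### Limits of loose 1-cells -/

namespace ColaxCone

variable {A : FCat.{w, v, u}} {a b : A.obj} {f : a ⟶ b}

theorem precomp_cell {X Y : A.obj} (t : X ⟶ Y) (c : ColaxCone f Y) :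
    SameCell (precomp t c).cell (t ◁ c.cell) := by
  change SameCell (t ◁ c.cell ≫ (α_ t c.fst f).inv) _
  rw [Strict.associator_eqToIso, eqToIso.inv]
  exact SameCell.comp_eqToHom _ _

theorem ext_same {X : A.obj} {c c' : ColaxCone f X} (h₁ : c.fst = c'.fst) (h₂ : c.snd = c'.snd)
    (h : SameCell c.cell c'.cell) : c = c' := by
  obtain ⟨r, s, α⟩ := c
  obtain ⟨r', s', α'⟩ := c'
  dsimp only at h₁ h₂ h
  subst h₁ h₂
  rw [h.eq]

namespace IsUniversal

variable {ps : Prop} {C : A.obj} {L : ColaxCone f C}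

theorem hom_ext (hL : L.IsUniversal (fun c => ps → IsIso c.cell))
    {X : A.obj} {t t' : X ⟶ C} (h₁ : t ≫ L.fst = t' ≫ L.fst)
    (h₂ : t ≫ L.snd = t' ≫ L.snd) (h : SameCell (t ◁ L.cell) (t' ◁ L.cell)) : t = t' := by
  obtain ⟨s, -, hs⟩ := hL.existsUnique_lift (precomp t' L) (fun hp => by
    have := hL.prop hp
    exact (precomp_cell t' L).symm.isIso inferInstance)
  rw [hs t' rfl]
  exact hs t (ext_same h₁ h₂
    ((precomp_cell t L).trans (h.trans (precomp_cell t' L).symm)))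

theorem exists_lift (hL : L.IsUniversal (fun c => ps → IsIso c.cell))
    {X : A.obj} {r : X ⟶ a} {s : X ⟶ b} (α : s ⟶ r ≫ f) (hα : ps → IsIso α) :
    ∃ t : X ⟶ C, t ≫ L.fst = r ∧ t ≫ L.snd = s ∧ SameCell (t ◁ L.cell) α := by
  obtain ⟨t, ht, -⟩ := hL.existsUnique_lift ⟨r, s, α⟩ hα
  refine ⟨t, congrArg ColaxCone.fst ht, congrArg ColaxCone.snd ht, ?_⟩
  have h := precomp_cell t L
  rw [ht] at h
  exact h.symm

theorem existsUnique_cell (hL : L.IsUniversal (fun c => ps → IsIso c.cell))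
    {X : A.obj} {t t' : X ⟶ C} (θ₁ : t ≫ L.fst ⟶ t' ≫ L.fst)
    (θ₂ : t ≫ L.snd ⟶ t' ≫ L.snd)
    (h : (precomp t L).cell ≫ θ₁ ▷ f = θ₂ ≫ (precomp t' L).cell) :
    ∃! φ : t ⟶ t', φ ▷ L.fst = θ₁ ∧ φ ▷ L.snd = θ₂ := by
  have hp : ∀ t : X ⟶ C, ps → IsIso (precomp t L).cell := fun t hp => by
    have := hL.prop hp
    exact (precomp_cell t L).symm.isIso inferInstance
  obtain ⟨φ, hφ, hu⟩ := hL.existsUnique_lift₂ (precomp t L) (precomp t' L) (hp t) (hp t') t t' rfl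
    rfl θ₁ θ₂ h
  exact ⟨φ, ⟨hφ.1.eq, hφ.2.eq⟩, fun ψ hψ =>
    hu ψ ⟨SameCell.of_eq hψ.1, SameCell.of_eq hψ.2⟩⟩

theorem cell_ext (hL : L.IsUniversal (fun c => ps → IsIso c.cell))
    {X : A.obj} {t t' : X ⟶ C} {φ ψ : t ⟶ t'} (h₁ : φ ▷ L.fst = ψ ▷ L.fst)
    (h₂ : φ ▷ L.snd = ψ ▷ L.snd) : φ = ψ := by
  refine (hL.existsUnique_cell (ψ ▷ L.fst) (ψ ▷ L.snd) ?_).unique ⟨h₁, h₂⟩ ⟨rfl, rfl⟩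
  -- Interchange supplies the compatibility needed to apply the two-dimensional universal property
  -- to the whiskerings of `ψ`.
  have e := Bicategory.whisker_exchange ψ L.cell
  have h₁ : SameCell ((precomp t L).cell ≫ ψ ▷ L.fst ▷ f) (t ◁ L.cell ≫ ψ ▷ (L.fst ≫ f)) :=
    (precomp_cell t L).comp (SameCell.whiskerRight_comp _ _ _).symm
  have h₂ : SameCell (ψ ▷ L.snd ≫ (precomp t' L).cell) (ψ ▷ L.snd ≫ t' ◁ L.cell) :=
    (SameCell.refl _).comp (precomp_cell t' L)
  exact (h₁.trans (e ▸ h₂.symm)).eq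

/-- The tight projection from the limit is part of a reflection, whose right adjoint is a section
through which `f` factors and whose unit is given by the universal 2-cell. -/
theorem exists_reflection (hL : L.IsUniversal (fun c => ps → IsIso c.cell)) :
    ∃ (t : a ⟶ C) (η : 𝟙 C ⟶ L.fst ≫ t),
    IsReflectionUnit L.fst t η ∧ (ps → IsIso η) ∧ t ≫ L.snd = f ∧
      SameCell (η ▷ L.snd) L.cell ∧ SameCell (t ◁ L.cell) (𝟙 f) := by
  -- The cone `(𝟙, id, f)` has an invertible 2-cell, so it is admissible whether or not `ps` holds.
  obtain ⟨t, ht₁, ht₂, ht⟩ := hL.exists_lift (eqToHom (Strict.id_comp f).symm)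
    (fun _ => inferInstance)
  have ht' := ht.trans (SameCell.eqToHom_id _)
  have e₁ : 𝟙 C ≫ L.fst = (L.fst ≫ t) ≫ L.fst := by
    rw [Strict.assoc, ht₁, Strict.comp_id, Strict.id_comp]
  have e₂ : L.fst ≫ f = (L.fst ≫ t) ≫ L.snd := by rw [Strict.assoc, ht₂]
  have c₁ : SameCell (precomp (𝟙 C) L).cell L.cell :=
    (precomp_cell _ _).trans (SameCell.id_whiskerLeft _)
  have c₂ : SameCell (precomp (L.fst ≫ t) L).cell (𝟙 (L.fst ≫ f)) :=
    (precomp_cell _ _).trans ((SameCell.comp_whiskerLeft _ _ _).trans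
      (SameCell.whiskerLeft_id _ ht'))
  -- The unit is induced by an identity over `L.fst` and by `L.cell` over `L.snd`. Both sides of the
  -- compatibility condition are then `L.cell`.
  obtain ⟨η, ⟨hη₁, hη₂⟩, -⟩ := hL.existsUnique_cell (t := 𝟙 C) (t' := L.fst ≫ t) (eqToHom e₁)
    (eqToHom (Strict.id_comp _) ≫ L.cell ≫ eqToHom e₂) (by
      refine SameCell.eq (SameCell.trans ?_ (SameCell.comp_id _ c₂).symm)
      refine (SameCell.comp_id _ (SameCell.id_whiskerRight (SameCell.eqToHom_id e₁) f)).trans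
        (c₁.trans ?_)
      exact ((SameCell.eqToHom_comp _ _).trans (SameCell.comp_eqToHom _ _)).symm)
  have s₁ : SameCell (η ▷ L.fst) (𝟙 L.fst) :=
    (SameCell.of_eq hη₁).trans ((SameCell.eqToHom_id _).trans
      (SameCell.id_congr (Strict.id_comp _)))
  have s₂ : SameCell (η ▷ L.snd) L.cell := (SameCell.of_eq hη₂).trans
    ((SameCell.eqToHom_comp _ _).trans (SameCell.comp_eqToHom _ _))
  refine ⟨t, η, ⟨ht₁, s₁, ?_⟩, fun hp => ?_, ht₂, s₂, ht'⟩
  · have e₃ : t ≫ 𝟙 C = t ≫ L.fst ≫ t := by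
      rw [Strict.comp_id, ← Strict.assoc, ht₁, Strict.id_comp]
    -- The projections are jointly faithful on 2-cells: over `L.fst` the unit is an identity, over
    -- `L.snd` it becomes `t ◁ L.cell`, an identity by the choice of `t`.
    have : t ◁ η = eqToHom e₃ := by
      refine hL.cell_ext (SameCell.eq ?_) (SameCell.eq ?_)
      · refine (SameCell.whisker_assoc _ _ _).trans ((SameCell.whiskerLeft_id _ s₁).trans ?_)
        exact ((SameCell.id_whiskerRight (SameCell.eqToHom_id e₃) _).trans
          (SameCell.id_congr (by rw [Strict.comp_id]))).symm
      · refine (SameCell.whisker_assoc _ _ _).trans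
          ((SameCell.whiskerLeft rfl s₂).trans (ht'.trans ?_))
        exact ((SameCell.id_whiskerRight (SameCell.eqToHom_id e₃) _).trans
          (SameCell.id_congr (by rw [Strict.comp_id, ht₂]))).symm
    rw [this]
    exact (SameCell.eqToHom_id _).trans (SameCell.id_congr (Strict.comp_id t))
  · have := hL.prop hp
    -- The inverse of the unit is induced in the same way by the inverse of `L.cell`.
    obtain ⟨ζ, ⟨hζ₁, hζ₂⟩, -⟩ := hL.existsUnique_cell (t := L.fst ≫ t) (t' := 𝟙 C)
      (eqToHom e₁.symm) (eqToHom e₂.symm ≫ inv L.cell ≫ eqToHom (Strict.id_comp _).symm) (by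
        refine SameCell.eq (SameCell.trans (SameCell.id_comp c₂ _) ?_)
        refine (SameCell.id_whiskerRight (SameCell.eqToHom_id e₁.symm) f).trans ?_
        refine SameCell.symm ((SameCell.comp (SameCell.trans (SameCell.eqToHom_comp _ _)
          (SameCell.comp_eqToHom _ _)) c₁).trans ?_)
        rw [IsIso.inv_hom_id]
        exact SameCell.id_congr (by rw [← e₁, Strict.id_comp]))
    refine ⟨ζ, hL.cell_ext ?_ ?_, hL.cell_ext ?_ ?_⟩
    · simp [hη₁, hζ₁]
    · simp [hη₂, hζ₂]
    · simp [hη₁, hζ₁]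
    · simp [hη₂, hζ₂]

end IsUniversal

end ColaxCone

/-! ### Diagonal fillers -/

/-- Allows units in `W` to be compared when their adjunctions agree only up to propositional
equality of 1-cells. -/
theorem IsReflectionUnit.same {B : Type u} [Bicategory.{w, v} B] [Strict B] {a b : B}
    {f f' : a ⟶ b} {g g' : b ⟶ a} {η : 𝟙 a ⟶ f ≫ g} {η' : 𝟙 a ⟶ f' ≫ g'} (hf : f = f')
    (hg : g = g') (h : IsReflectionUnit f g η) (h' : IsReflectionUnit f' g' η') :
    SameCell η η' := by
  subst hf hg
  exact SameCell.of_eq (h.unit_unique h')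

/-- A reflection with invertible unit lifts 2-cells along its right adjoint. -/
theorem IsReflectionUnit.exists_cell {B : Type u} [Bicategory.{w, v} B] [Strict B] {a b c : B}
    {f : a ⟶ b} {g : b ⟶ a} {η : 𝟙 a ⟶ f ≫ g} (h : IsReflectionUnit f g η) [IsIso η]
    {q q' : a ⟶ c} {x y : b ⟶ c} (hx : g ≫ q = x) (hy : g ≫ q' = y) (α : x ⟶ y) :
    ∃ β : q ⟶ q', SameCell (g ◁ β) α := by
  subst hx hy
  have hi : SameCell (g ◁ inv η) (𝟙 g) := by
    have e : g ◁ η ≫ g ◁ inv η = 𝟙 _ := by rw [← Bicategory.whiskerLeft_comp]; simp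
    exact (SameCell.id_comp h.right _).symm.trans
      ((SameCell.of_eq e).trans (SameCell.id_congr (Strict.comp_id g)))
  -- The lift is `q ⟶ f ≫ g ≫ q ⟶ f ≫ g ≫ q' ⟶ q'`, given by the unit, `α` and the inverse unit.
  -- Whiskering with `g` turns both unit parts into identities.
  refine ⟨eqToHom (Strict.id_comp q).symm ≫ η ▷ q ≫ eqToHom (Strict.assoc _ _ _) ≫ f ◁ α ≫
    eqToHom (Strict.assoc _ _ _).symm ≫ inv η ▷ q' ≫ eqToHom (Strict.id_comp q'), ?_⟩
  simp only [Bicategory.whiskerLeft_comp]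
  refine (SameCell.id_comp (SameCell.whiskerLeft_id g (SameCell.eqToHom_id _)) _).trans ?_
  refine (SameCell.id_comp ((SameCell.whisker_assoc _ _ _).symm.trans
    (SameCell.id_whiskerRight h.right q)) _).trans ?_
  refine (SameCell.id_comp (SameCell.whiskerLeft_id g (SameCell.eqToHom_id _)) _).trans ?_
  refine SameCell.trans ?_ ((SameCell.comp_whiskerLeft g f α).symm.trans
    ((SameCell.whiskerLeft h.comp_eq (SameCell.refl α)).trans (SameCell.id_whiskerLeft α)))
  refine SameCell.comp_id _ (k := g ≫ q') ?_
  refine (SameCell.id_comp (SameCell.whiskerLeft_id g (SameCell.eqToHom_id _)) _).trans ?_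
  refine (SameCell.id_comp ((SameCell.whisker_assoc _ _ _).symm.trans
    (SameCell.id_whiskerRight hi q')) _).trans ?_
  exact SameCell.whiskerLeft_id g (SameCell.eqToHom_id' _)

/-- Every loose 1-cell has a limit with respect to all colax cones, or to those with invertible
2-cell if `ps` holds. -/
def FCat.HasConeLimits (A : FCat.{w, v, u}) (ps : Prop) : Prop :=
  ∀ {a b : A.obj} (f : a ⟶ b), ∃ (C : A.obj) (L : ColaxCone f C),
    L.IsUniversal (fun c => ps → IsIso c.cell)

/-- A commuting square from the inclusion of tight 1-cells in `A` to the F-functor `m`, with a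
given action on objects. -/
structure TightSquare (A : FCat.{w, v, u}) {Z W : FCat.{w, v, u}} (m : FFunctor Z W)
    (ρ : A.obj → Z.obj) where
  r : ∀ {a b : A.obj} (f : a ⟶ b), A.Tight f → (ρ a ⟶ ρ b)
  r_tight : ∀ {a b : A.obj} (f : a ⟶ b) (hf : A.Tight f), Z.Tight (r f hf)
  r_id : ∀ a : A.obj, r (𝟙 a) (A.tight_id a) = 𝟙 (ρ a)
  r_comp : ∀ {a b c : A.obj} (f : a ⟶ b) (g : b ⟶ c) (hf : A.Tight f) (hg : A.Tight g),
    r (f ≫ g) (A.tight_comp f g hf hg) = r f hf ≫ r g hg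
  r₂ : ∀ {a b : A.obj} {f g : a ⟶ b} (hf : A.Tight f) (hg : A.Tight g), (f ⟶ g) →
    (r f hf ⟶ r g hg)
  s : TwoFunctorOver (X := A.obj) (Y := W.obj) (fun a => m.obj (ρ a))
  s_map : ∀ {a b : A.obj} (f : a ⟶ b) (hf : A.Tight f), s.map f = m.map (r f hf)
  s_map₂ : ∀ {a b : A.obj} {f g : a ⟶ b} (hf : A.Tight f) (hg : A.Tight g) (α : f ⟶ g),
    SameCell (s.map₂ α) (m.map₂ (r₂ hf hg α))

namespace TightSquare

variable {ps : Prop} {A Z W : FCat.{w, v, u}} {m : FFunctor Z W} {ρ : A.obj → Z.obj}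
  (D : TightSquare A m ρ)

theorem r_comp' {a b c : A.obj} {f : a ⟶ b} {g : b ⟶ c} {h : a ⟶ c} (hf : A.Tight f)
    (hg : A.Tight g) (hh : A.Tight h) (e : f ≫ g = h) : D.r f hf ≫ D.r g hg = D.r h hh := by
  subst e
  exact (D.r_comp f g hf hg).symm

/-- The right adjoint `t` of `p` lifts to the right adjoint `t'`. -/
def LiftsTo (ps : Prop) {a b : A.obj} {p : a ⟶ b} (hp : A.Tight p) (t : b ⟶ a)
    (t' : ρ b ⟶ ρ a) : Prop :=
  IsReflection ps (D.r p hp) t' ∧ m.map t' = D.s.map t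

theorem LiftsTo.id (a : A.obj) : D.LiftsTo ps (A.tight_id a) (𝟙 a) (𝟙 (ρ a)) :=
  ⟨(D.r_id a).symm ▸ IsReflection.id _, by rw [m.map_id, D.s.map_id]⟩

variable {D} in
theorem LiftsTo.comp {a b c : A.obj} {p : a ⟶ b} {hp : A.Tight p} {t : b ⟶ a} {t' : ρ b ⟶ ρ a}
    {q : b ⟶ c} {hq : A.Tight q} {u : c ⟶ b} {u' : ρ c ⟶ ρ b} (h : D.LiftsTo ps hp t t')
    (h' : D.LiftsTo ps hq u u') :
    D.LiftsTo ps (A.tight_comp p q hp hq) (u ≫ t) (u' ≫ t') :=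
  ⟨(D.r_comp p q hp hq).symm ▸ h.1.comp h'.1, by rw [m.map_comp, D.s.map_comp, h.2, h'.2]⟩

theorem exists_liftsTo (hR : m.LiftsReflections ps) {a b : A.obj} {p : a ⟶ b} (hp : A.Tight p)
    {t : b ⟶ a} (h : IsReflection ps p t) : ∃ t', D.LiftsTo ps hp t t' :=
  (hR (D.r p hp) (D.r_tight p hp) (D.s.map t)
    (D.s_map p hp ▸ D.s.map_isReflection h)).exists

/-- The value at a loose 1-cell `f` of a diagonal filler: it does not depend on the way in
which `f` is written as a composite of a tight 1-cell and a right adjoint of a tight 1-cell. -/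
theorem exists_value (hA : A.HasConeLimits ps) (hR : m.LiftsReflections ps)
    (hM : m.LiftsReflectionMorphisms ps) {a b : A.obj} (f : a ⟶ b) :
    ∃ k : ρ a ⟶ ρ b, ∀ {c d : A.obj} {x : c ⟶ a} (hx : A.Tight x) {P : d ⟶ c} (hP : A.Tight P)
      {Q : d ⟶ b} (hQ : A.Tight Q) {T : c ⟶ d} {T' : ρ c ⟶ ρ d}, IsReflection ps P T →
        T ≫ Q = x ≫ f → D.LiftsTo ps hP T T' → T' ≫ D.r Q hQ = D.r x hx ≫ k := by
  obtain ⟨C, L, hL⟩ := hA f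
  obtain ⟨t, η, hη, hi, htq, -, ht⟩ := hL.exists_reflection
  obtain ⟨t', ht'⟩ := D.exists_liftsTo hR hL.tight_fst ⟨η, hη, hi⟩
  refine ⟨t' ≫ D.r L.snd hL.tight_snd, ?_⟩
  rintro c d x hx P hP Q hQ T T' ⟨θ, hθ, hθi⟩ hTQ hT'
  have e : (P ≫ T) ≫ Q = (P ≫ x) ≫ f := by rw [Strict.assoc, hTQ, Strict.assoc]
  have hα : SameCell (eqToHom (Strict.id_comp Q).symm ≫ θ ▷ Q ≫ eqToHom e) (θ ▷ Q) :=
    (SameCell.eqToHom_comp _ _).trans (SameCell.comp_eqToHom _ _)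
  -- The 2-cell `θ ▷ Q : Q ⟶ P ≫ T ≫ Q = P ≫ x ≫ f` is a cone over `f`. Its factorisation `u` has
  -- tight components `P ≫ x` and `Q`, hence is tight.
  obtain ⟨u, hu₁, hu₂, hu⟩ := hL.exists_lift _ (fun hp => hα.symm.isIso (by
    have := hθi hp
    infer_instance))
  have hut : A.Tight u := (hL.tight_iff u).2
    ⟨hu₁ ▸ A.tight_comp P x hP hx, hu₂ ▸ hQ⟩
  have hTu : T ≫ u = x ≫ t := by
    refine hL.hom_ext ?_ ?_ ?_
    · rw [Strict.assoc, hu₁, ← Strict.assoc, hθ.comp_eq, Strict.id_comp, Strict.assoc, hη.comp_eq,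
        Strict.comp_id]
    · rw [Strict.assoc, hu₂, hTQ, Strict.assoc, htq]
    -- Both 2-cells are identities: one is `T ◁ θ ▷ Q`, the other `x ◁ t ◁ L.cell`.
    · refine (SameCell.comp_whiskerLeft _ _ _).trans ?_
      refine (SameCell.whiskerLeft rfl (hu.trans hα)).trans ?_
      refine (SameCell.whisker_assoc _ _ _).symm.trans
        ((SameCell.id_whiskerRight hθ.right Q).trans ?_)
      exact (SameCell.id_congr hTQ).trans ((SameCell.comp_whiskerLeft _ _ _).trans
        (SameCell.whiskerLeft_id x ht)).symm
  -- The square `(u, x)` is a morphism of reflections from `P ⊣ T` to `L.fst ⊣ t`. The right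
  -- adjoints of the lifted square commute in `W`, as the image of `T ≫ u = x ≫ t` under `s`, hence
  -- in `Z`.
  have key := hM (D.r_tight P hP) (D.r_tight L.fst hL.tight_fst) hT'.1 ht'.1 (D.r_tight u hut)
    (D.r_tight x hx)
    ((D.r_comp' hut hL.tight_fst (A.tight_comp P x hP hx) hu₁).trans (D.r_comp P x hP hx))
    (by rw [hT'.2, ht'.2, ← D.s_map, ← D.s_map, ← D.s.map_comp, hTu, D.s.map_comp])
  rw [← D.r_comp' hut hL.tight_snd hQ hu₂, ← Strict.assoc, key, Strict.assoc]

/-- The values of a diagonal filler at loose 1-cells. -/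
structure Values (ps : Prop) where
  val : ∀ {a b : A.obj}, (a ⟶ b) → (ρ a ⟶ ρ b)
  eq_comp : ∀ {a b c d : A.obj} (f : a ⟶ b) {x : c ⟶ a} (hx : A.Tight x) {P : d ⟶ c}
    (hP : A.Tight P) {Q : d ⟶ b} (hQ : A.Tight Q) {T : c ⟶ d} {T' : ρ c ⟶ ρ d},
    IsReflection ps P T → T ≫ Q = x ≫ f → D.LiftsTo ps hP T T' → T' ≫ D.r Q hQ = D.r x hx ≫ val f

theorem nonempty_values (hA : A.HasConeLimits ps) (hR : m.LiftsReflections ps)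
    (hM : m.LiftsReflectionMorphisms ps) : Nonempty (D.Values ps) :=
  ⟨fun {_ _} f => (D.exists_value hA hR hM f).choose,
    fun {_ _ _ _} f => (D.exists_value hA hR hM f).choose_spec⟩

namespace Values

variable {D} (K : D.Values ps)

theorem val_eq {a b d : A.obj} {f : a ⟶ b} {P : d ⟶ a} (hP : A.Tight P) {Q : d ⟶ b}
    (hQ : A.Tight Q) {T : a ⟶ d} {T' : ρ a ⟶ ρ d} (h : IsReflection ps P T) (hf : T ≫ Q = f)
    (h' : D.LiftsTo ps hP T T') : T' ≫ D.r Q hQ = K.val f := by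
  rw [K.eq_comp f (A.tight_id a) hP hQ h (hf.trans (Strict.id_comp f).symm) h', D.r_id,
    Strict.id_comp]

theorem val_tight {a b : A.obj} (f : a ⟶ b) (hf : A.Tight f) : K.val f = D.r f hf := by
  rw [← K.val_eq (A.tight_id a) hf (IsReflection.id a) (Strict.id_comp f) (LiftsTo.id D a),
    Strict.id_comp]

/-- With `f = t ≫ q` and `q ≫ g = u ≫ q'`, composing reflections gives `f ≫ g = (t ≫ u) ≫ q'`. The
tight 1-cell `x` in `eq_comp` is there for this: it compares the lift of `u` followed by `r q'` with
`r q ≫ val g`. -/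
theorem val_comp (hA : A.HasConeLimits ps) (hR : m.LiftsReflections ps) {a b c : A.obj}
    (f : a ⟶ b) (g : b ⟶ c) : K.val (f ≫ g) = K.val f ≫ K.val g := by
  obtain ⟨C, L, hL⟩ := hA f
  obtain ⟨t, η, hη, hi, htq, -, -⟩ := hL.exists_reflection
  obtain ⟨t', ht'⟩ := D.exists_liftsTo hR hL.tight_fst ⟨η, hη, hi⟩
  obtain ⟨E, M, hM⟩ := hA (L.snd ≫ g)
  obtain ⟨u, θ, hθ, hj, huq, -, -⟩ := hM.exists_reflection
  obtain ⟨u', hu'⟩ := D.exists_liftsTo hR hM.tight_fst ⟨θ, hθ, hj⟩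
  have h := (IsReflection.comp ⟨θ, hθ, hj⟩ ⟨η, hη, hi⟩ :
    IsReflection ps (M.fst ≫ L.fst) (t ≫ u))
  rw [← K.val_eq hL.tight_fst hL.tight_snd ⟨η, hη, hi⟩ htq ht',
    ← K.val_eq (A.tight_comp _ _ hM.tight_fst hL.tight_fst) hM.tight_snd h
      (by rw [Strict.assoc, huq, ← Strict.assoc, htq]) (hu'.comp ht'),
    Strict.assoc, Strict.assoc,
    K.eq_comp g hL.tight_snd hM.tight_fst hM.tight_snd ⟨θ, hθ, hj⟩ huq hu']

theorem map_val (hA : A.HasConeLimits ps) (hR : m.LiftsReflections ps) {a b : A.obj}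
    (f : a ⟶ b) : m.map (K.val f) = D.s.map f := by
  obtain ⟨C, L, hL⟩ := hA f
  obtain ⟨t, η, hη, hi, htq, -, -⟩ := hL.exists_reflection
  obtain ⟨t', ht'⟩ := D.exists_liftsTo hR hL.tight_fst ⟨η, hη, hi⟩
  rw [← K.val_eq hL.tight_fst hL.tight_snd ⟨η, hη, hi⟩ htq ht', m.map_comp, ht'.2, ← D.s_map,
    ← D.s.map_comp, htq]

/-- A limit of `L.fst ≫ g` yields one right adjoint `T` through which both `f` and `g` factor, say
`f = T ≫ Q` and `g = T ≫ Q'` with `Q`, `Q'` tight. As the unit is invertible, `α = T ◁ β` for some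
`β : Q ⟶ Q'`, on which `r` is defined. -/
theorem exists_cell_of_iso (hps : ps) (hA : A.HasConeLimits ps) (hR : m.LiftsReflections ps)
    {a b : A.obj} {f g : a ⟶ b} (α : f ⟶ g) :
    ∃ κ : K.val f ⟶ K.val g, SameCell (m.map₂ κ) (D.s.map₂ α) := by
  obtain ⟨C, L, hL⟩ := hA f
  obtain ⟨t, η, hη, hi, htq, -, -⟩ := hL.exists_reflection
  obtain ⟨E, M, hM⟩ := hA (L.fst ≫ g)
  obtain ⟨u, θ, hθ, hj, huq, -, -⟩ := hM.exists_reflection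
  have h := (IsReflection.comp ⟨θ, hθ, hj⟩ ⟨η, hη, hi⟩ :
    IsReflection ps (M.fst ≫ L.fst) (t ≫ u))
  have hp := A.tight_comp _ _ hM.tight_fst hL.tight_fst
  have hq := A.tight_comp _ _ hM.tight_fst hL.tight_snd
  obtain ⟨T', hT'⟩ := D.exists_liftsTo hR hp h
  have e₁ : (t ≫ u) ≫ M.fst ≫ L.snd = f := by
    rw [Strict.assoc, ← Strict.assoc u, hθ.comp_eq, Strict.id_comp, htq]
  have e₂ : (t ≫ u) ≫ M.snd = g := by
    rw [Strict.assoc, huq, ← Strict.assoc, hη.comp_eq, Strict.id_comp]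
  obtain ⟨ζ, hζ, hζi⟩ := id h
  have := hζi hps
  obtain ⟨β, hβ⟩ := hζ.exists_cell e₁ e₂ α
  refine ⟨eqToHom (K.val_eq hp hq h e₁ hT').symm ≫ T' ◁ D.r₂ hq hM.tight_snd β ≫
    eqToHom (K.val_eq hp hM.tight_snd h e₂ hT'), ?_⟩
  let m' := TwoFunctorOver.ofStrict m.toStrictPseudofunctor
  refine (m'.map₂_same ((SameCell.eqToHom_comp _ _).trans (SameCell.comp_eqToHom _ _))).trans ?_
  refine (m'.map₂_whiskerLeft _ _).trans ?_
  refine (SameCell.whiskerLeft hT'.2 (D.s_map₂ hq hM.tight_snd β).symm).trans ?_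
  exact (D.s.map₂_whiskerLeft _ _).symm.trans (D.s.map₂_same hβ)

/-- Pasting `α` onto the universal cone of `f` gives a cone over `g`, in general not invertible,
hence the hypothesis `¬ ps`. It induces a tight `v` between the limits, and `α` is recovered as the
unit `θ` for `g` whiskered by `t ≫ v` and `M.snd`. Whiskering the lifted unit `θ'` likewise gives
the lift. -/
theorem exists_cell_of_not_iso (hps : ¬ ps) (hA : A.HasConeLimits ps)
    (hR : m.LiftsReflections ps) {a b : A.obj} {f g : a ⟶ b} (α : f ⟶ g) :
    ∃ κ : K.val f ⟶ K.val g, SameCell (m.map₂ κ) (D.s.map₂ α) := by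
  obtain ⟨C, L, hL⟩ := hA f
  obtain ⟨t, η, hη, hi, htq, -, ht⟩ := hL.exists_reflection
  obtain ⟨t', ht'⟩ := D.exists_liftsTo hR hL.tight_fst ⟨η, hη, hi⟩
  obtain ⟨E, M, hM⟩ := hA g
  obtain ⟨u, θ, hθ, hj, huq, hθq, -⟩ := hM.exists_reflection
  obtain ⟨u', hu'⟩ := D.exists_liftsTo hR hM.tight_fst ⟨θ, hθ, hj⟩
  obtain ⟨v, hv₁, hv₂, hv⟩ := hM.exists_lift (L.cell ≫ L.fst ◁ α) (fun hp => absurd hp hps)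
  have hvt : A.Tight v := (hM.tight_iff v).2 ⟨hv₁ ▸ hL.tight_fst, hv₂ ▸ hL.tight_snd⟩
  obtain ⟨θ', hθ', -⟩ := id hu'.1
  let m' := TwoFunctorOver.ofStrict m.toStrictPseudofunctor
  -- Both are units for the same right adjoint in `W`, so they agree.
  have hθθ' : SameCell (m.map₂ θ') (D.s.map₂ θ) :=
    (m'.mapUnit_same θ').symm.trans ((IsReflectionUnit.same (D.s_map M.fst hM.tight_fst).symm hu'.2
      (m'.map_isReflectionUnit hθ') (D.s.map_isReflectionUnit hθ)).trans (D.s.mapUnit_same θ))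
  have hcell : SameCell ((t ≫ v) ◁ θ ▷ M.snd) α := by
    refine (SameCell.comp_whiskerLeft _ _ _).trans ?_
    refine (SameCell.whiskerLeft rfl ((SameCell.whiskerLeft rfl hθq).trans hv)).trans ?_
    rw [Bicategory.whiskerLeft_comp]
    refine (SameCell.id_comp ht _).trans ((SameCell.comp_whiskerLeft _ _ _).symm.trans ?_)
    exact (SameCell.whiskerLeft hη.comp_eq (SameCell.refl α)).trans (SameCell.id_whiskerLeft α)
  have hf := K.val_eq hL.tight_fst hL.tight_snd ⟨η, hη, hi⟩ htq ht'
  have hg := K.val_eq hM.tight_fst hM.tight_snd ⟨θ, hθ, hj⟩ huq hu'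
  have e₁ : K.val f = (t' ≫ D.r v hvt) ≫ 𝟙 _ ≫ D.r M.snd hM.tight_snd := by
    rw [Strict.id_comp, Strict.assoc, D.r_comp' hvt hM.tight_snd hL.tight_snd hv₂, hf]
  have e₂ : (t' ≫ D.r v hvt) ≫ (D.r M.fst hM.tight_fst ≫ u') ≫ D.r M.snd hM.tight_snd =
      K.val g := by
    obtain ⟨ξ, hξ, -⟩ := ht'.1
    rw [Strict.assoc, Strict.assoc, ← Strict.assoc (D.r v hvt),
      D.r_comp' hvt hM.tight_fst hL.tight_fst hv₁, ← Strict.assoc, hξ.comp_eq, Strict.id_comp, hg]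
  refine ⟨eqToHom e₁ ≫ (t' ≫ D.r v hvt) ◁ θ' ▷ D.r M.snd hM.tight_snd ≫ eqToHom e₂, ?_⟩
  refine (m'.map₂_same ((SameCell.eqToHom_comp _ _).trans (SameCell.comp_eqToHom _ _))).trans ?_
  refine (m'.map₂_whiskerLeft _ _).trans ?_
  refine (SameCell.whiskerLeft (f' := D.s.map (t ≫ v)) ?_ ((m'.map₂_whiskerRight _ _).trans
    (hθθ'.whiskerRight (D.s_map M.snd hM.tight_snd).symm))).trans ?_
  · rw [D.s.map_comp, ← ht'.2, D.s_map v hvt]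
    exact m.map_comp _ _
  · exact (SameCell.whiskerLeft rfl (D.s.map₂_whiskerRight _ _).symm).trans
      ((D.s.map₂_whiskerLeft _ _).symm.trans (D.s.map₂_same hcell))

end Values

theorem _root_.FFunctor.LocallyFaithful.same (hF : m.LocallyFaithful) {a b : Z.obj}
    {f g f' g' : a ⟶ b} {α : f ⟶ g} {β : f' ⟶ g'} (hf : f = f') (hg : g = g')
    (h : SameCell (m.map₂ α) (m.map₂ β)) : SameCell α β := by
  subst hf hg
  exact SameCell.of_eq (hF _ _ h.eq)

/-- The 2-functor `K` is a diagonal filler. -/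
structure IsFiller (K : TwoFunctorOver (X := A.obj) (Y := Z.obj) ρ) : Prop where
  map_tight : ∀ {a b : A.obj} (f : a ⟶ b) (hf : A.Tight f), K.map f = D.r f hf
  map_map : ∀ {a b : A.obj} (f : a ⟶ b), m.map (K.map f) = D.s.map f
  map₂_map₂ : ∀ {a b : A.obj} {f g : a ⟶ b} (α : f ⟶ g),
    SameCell (m.map₂ (K.map₂ α)) (D.s.map₂ α)

/-- By local faithfulness, any choice of lifts of the 2-cells `s α` is a 2-functor: each law may be
checked after applying `m`, where it is a law for `s`. -/
theorem exists_isFiller (hA : A.HasConeLimits ps) (hR : m.LiftsReflections ps)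
    (hM : m.LiftsReflectionMorphisms ps) (hF : m.LocallyFaithful) : ∃ K, D.IsFiller K := by
  obtain ⟨K⟩ := D.nonempty_values hA hR hM
  have hκ : ∀ {a b : A.obj} {f g : a ⟶ b} (α : f ⟶ g),
      ∃ κ : K.val f ⟶ K.val g, SameCell (m.map₂ κ) (D.s.map₂ α) := by
    intro a b f g α
    by_cases hps : ps
    · exact K.exists_cell_of_iso hps hA hR α
    · exact K.exists_cell_of_not_iso hps hA hR α
  choose κ hκ using @hκ
  let m' := TwoFunctorOver.ofStrict m.toStrictPseudofunctor
  refine ⟨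
    { map := K.val
      map₂ := κ
      map_id := fun a => by rw [K.val_tight _ (A.tight_id a), D.r_id]
      map_comp := K.val_comp hA hR
      map₂_id := fun f => (hF.same rfl rfl ((hκ _).trans ?_)).eq
      map₂_comp := fun α β => (hF.same rfl rfl ((hκ _).trans ?_)).eq
      map₂_whiskerLeft := fun f _ _ α =>
        hF.same (K.val_comp hA hR _ _) (K.val_comp hA hR _ _) ((hκ _).trans ?_)
      map₂_whiskerRight := fun α h =>
        hF.same (K.val_comp hA hR _ _) (K.val_comp hA hR _ _) ((hκ _).trans ?_) },
    K.val_tight, K.map_val hA hR, hκ⟩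
  · exact (D.s.map₂_id_same (SameCell.refl _)).trans
      ((SameCell.id_congr (K.map_val hA hR f).symm).trans
        (m'.map₂_id_same (SameCell.refl _)).symm)
  · rw [D.s.map₂_comp, m.map₂_comp]
    exact (hκ α).symm.comp (hκ β).symm
  · exact (D.s.map₂_whiskerLeft _ _).trans
      ((SameCell.whiskerLeft (K.map_val hA hR f).symm (hκ α).symm).trans
        (m'.map₂_whiskerLeft _ _).symm)
  · exact (D.s.map₂_whiskerRight _ _).trans
      (((hκ α).symm.whiskerRight (K.map_val hA hR h).symm).trans
        (m'.map₂_whiskerRight _ _).symm)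

variable {D} in
theorem IsFiller.unique (hA : A.HasConeLimits ps) (hR : m.LiftsReflections ps)
    (hF : m.LocallyFaithful) {K K' : TwoFunctorOver (X := A.obj) (Y := Z.obj) ρ}
    (h : D.IsFiller K) (h' : D.IsFiller K') : K = K' := by
  have hm : ∀ {a b : A.obj} (f : a ⟶ b), K.map f = K'.map f := by
    intro a b f
    obtain ⟨C, L, hL⟩ := hA f
    obtain ⟨t, η, hη, hi, htq, -, -⟩ := hL.exists_reflection
    -- Both are right adjoint to the image of `L.fst` and lie over `s t`, so the uniqueness in
    -- `w`-Refl identifies them.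
    have ht : K.map t = K'.map t := by
      refine (hR (D.r L.fst hL.tight_fst) (D.r_tight _ _) (D.s.map t)
        (D.s_map L.fst hL.tight_fst ▸ D.s.map_isReflection ⟨η, hη, hi⟩)).unique
          ⟨?_, h.map_map t⟩ ⟨?_, h'.map_map t⟩
      · exact h.map_tight L.fst hL.tight_fst ▸ K.map_isReflection ⟨η, hη, hi⟩
      · exact h'.map_tight L.fst hL.tight_fst ▸ K'.map_isReflection ⟨η, hη, hi⟩
    rw [← htq, K.map_comp, K'.map_comp, ht, h.map_tight _ hL.tight_snd,
      h'.map_tight _ hL.tight_snd]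
  exact TwoFunctorOver.ext_same hm fun α =>
    hF.same (hm _) (hm _) ((h.map₂_map₂ α).trans (h'.map₂_map₂ α).symm)

end TightSquare

/-! ### Equality of F-functors -/

namespace FFunctor

variable {A B C : FCat.{w, v, u}}

theorem ext_heq {F G : FFunctor A B} (h : F.obj = G.obj)
    (h' : ∀ {a b : A.obj} (f : a ⟶ b), HEq (F.map f) (G.map f))
    (h'' : ∀ {a b : A.obj} {f g : a ⟶ b} (α : f ⟶ g), HEq (F.map₂ α) (G.map₂ α)) : F = G := by
  apply ext_prelax
  revert h h' h''
  generalize F.toPrelaxFunctor = F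
  generalize G.toPrelaxFunctor = G
  intro h h' h''
  obtain ⟨⟨⟨F, Fm⟩, Fm₂⟩, _, _⟩ := F
  obtain ⟨⟨⟨G, Gm⟩, Gm₂⟩, _, _⟩ := G
  dsimp only at h h' h''
  subst h
  obtain rfl : @Fm = @Gm := by
    funext a b f; exact eq_of_heq (h' f)
  obtain rfl : @Fm₂ = @Gm₂ := by
    funext a b f g α; exact eq_of_heq (h'' α)
  rfl

theorem obj_of_eq {F G : FFunctor A B} (h : F = G) : F.obj = G.obj :=
  h ▸ rfl

theorem map_of_eq {F G : FFunctor A B} (h : F = G) {a b : A.obj} (f : a ⟶ b) :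
    HEq (F.map f) (G.map f) :=
  h ▸ HEq.rfl

theorem map₂_of_eq {F G : FFunctor A B} (h : F = G) {a b : A.obj} {f g : a ⟶ b} (α : f ⟶ g) :
    HEq (F.map₂ α) (G.map₂ α) :=
  h ▸ HEq.rfl

end FFunctor

/-- The inclusion of tight 1-cells is orthogonal to the F-functors which lift reflections and their
morphisms and are locally faithful. -/
theorem FCat.orthogonal_j {ps : Prop} {A Z W : FCat.{w, v, u}} (hA : A.HasConeLimits ps)
    (m : Z ⟶ W) (hR : FFunctor.LiftsReflections ps m)
    (hM : FFunctor.LiftsReflectionMorphisms ps m) (hF : FFunctor.LocallyFaithful m) :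
    Orthogonal A.j m := by
  intro r s h
  obtain ⟨s, hs⟩ := s
  let ρ : A.obj → Z.obj := (FFunctor.toStrictPseudofunctor r).obj
  obtain ⟨S, rfl⟩ := TwoFunctorOver.exists_toStrict_eq
    (ρ := fun a => (FFunctor.toStrictPseudofunctor m).obj (ρ a)) s (FFunctor.obj_of_eq h).symm
  let R : TwoFunctorOver (X := A.tight.obj) ρ :=
    TwoFunctorOver.ofStrict (FFunctor.toStrictPseudofunctor r)
  have hmap : ∀ {a b : A.obj} (f : a ⟶ b) (hf : A.Tight f),
      S.map f = (FFunctor.toStrictPseudofunctor m).map (R.map (a := a) (b := b) ⟨f, hf⟩) :=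
    fun {a b} f hf => eq_of_heq (FFunctor.map_of_eq h (a := a) (b := b) ⟨f, hf⟩).symm
  let D : TightSquare A m ρ :=
    { r := fun {a b} f hf => R.map (a := a) (b := b) ⟨f, hf⟩
      r_tight := fun {a b} f hf => FFunctor.map_tight r (a := a) (b := b) ⟨f, hf⟩ trivial
      r_id := fun a => R.map_id a
      r_comp := fun {a b c} f g hf hg => R.map_comp (a := a) (b := b) (c := c) ⟨f, hf⟩ ⟨g, hg⟩
      r₂ := fun {a b f g} hf hg α => R.map₂ (a := a) (b := b) (f := ⟨f, hf⟩) (g := ⟨g, hg⟩) α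
      s := S
      s_map := hmap
      s_map₂ := fun {a b f g} hf hg α => SameCell.iff_heq.2 ⟨hmap f hf, hmap g hg,
        (FFunctor.map₂_of_eq h (a := a) (b := b) (f := ⟨f, hf⟩) (g := ⟨g, hg⟩) α).symm⟩ }
  obtain ⟨K, hK⟩ := D.exists_isFiller hA hR hM hF
  refine ⟨FFunctor.mk K.toStrict fun {a b} f hf =>
      (hK.map_tight f hf ▸ D.r_tight f hf : Z.Tight (K.map f)),
    ⟨?_, ?_⟩, ?_⟩
  · refine FFunctor.ext_heq rfl (fun f => heq_of_eq (hK.map_tight f.1 f.2)) fun {a b f g} α => ?_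
    exact (SameCell.iff_heq.1 (hF.same (hK.map_tight f.1 f.2) (hK.map_tight g.1 g.2)
      ((hK.map₂_map₂ α).trans (D.s_map₂ f.2 g.2 α)))).2.2
  · exact FFunctor.ext_heq rfl (fun f => heq_of_eq (hK.map_map f))
      fun α => (SameCell.iff_heq.1 (hK.map₂_map₂ α)).2.2
  · rintro ⟨k, hk⟩ ⟨h₁, h₂⟩
    obtain ⟨K', rfl⟩ := TwoFunctorOver.exists_toStrict_eq k
      (FFunctor.obj_of_eq h₁ : _ = ρ)
    have hK' : D.IsFiller K' :=
      { map_tight := fun {a b} f hf =>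
          eq_of_heq (FFunctor.map_of_eq h₁ (a := a) (b := b) ⟨f, hf⟩)
        map_map := fun f => eq_of_heq (FFunctor.map_of_eq h₂ f)
        map₂_map₂ := fun {a b f g} α => SameCell.iff_heq.2
          ⟨eq_of_heq (FFunctor.map_of_eq h₂ f), eq_of_heq (FFunctor.map_of_eq h₂ g),
            FFunctor.map₂_of_eq h₂ α⟩ }
    obtain rfl := hK'.unique hA hR hF hK
    rfl

/-! ### Duality -/

namespace FFunctor

variable {A B C : FCat.{w, v, u}}

/-- The dual of a morphism of F-CAT. -/
def coHom (F : A ⟶ B) : A.co ⟶ B.co :=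
  FFunctor.co F

/-- An F-functor between duals gives one between the original F-categories. -/
def unco (F : A.co ⟶ B.co) : A ⟶ B :=
  FFunctor.co F

theorem unco_coHom (F : A ⟶ B) : unco (coHom F) = F :=
  ext_prelax rfl

theorem coHom_comp (F : A ⟶ B) (G : B ⟶ C) : coHom (F ≫ G) = coHom F ≫ coHom G :=
  ext_prelax rfl

theorem unco_comp (F : A.co ⟶ B.co) (G : B.co ⟶ C.co) : unco (F ≫ G) = unco F ≫ unco G :=
  ext_prelax rfl

/-- Reversing 2-cells commutes on the nose with restricting to tight 1-cells. -/
theorem coHom_j : coHom A.j = A.co.j :=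
  ext_prelax rfl

theorem LocallyFaithful.co {m : FFunctor A B} (h : m.LocallyFaithful) : m.co.LocallyFaithful :=
  fun {a b _ _} α β e => h (a := Co.un a) (b := Co.un b) α β e

/-- Duality is an involution of F-CAT, so squares and their fillers correspond to those of the dual.
-/
theorem orthogonal_of_coHom {X Y : FCat.{w, v, u}} {e : X ⟶ Y} {m : A ⟶ B}
    (h : Orthogonal (coHom e) (coHom m)) : Orthogonal e m := by
  intro r s hrs
  obtain ⟨k, ⟨h₁, h₂⟩, hk⟩ := h (coHom r) (coHom s) (by rw [← coHom_comp, hrs, coHom_comp])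
  refine ⟨unco k, ⟨?_, ?_⟩, fun k' ⟨h₁', h₂'⟩ => ?_⟩
  · rw [← unco_coHom r, ← h₁, unco_comp, unco_coHom]
  · rw [← unco_coHom s, ← h₂, unco_comp, unco_coHom]
  · rw [← hk (coHom k') ⟨by rw [← coHom_comp, h₁'], by rw [← coHom_comp, h₂']⟩, unco_coHom]

end FFunctor

theorem ColaxCone.IsUniversal.congr {A : FCat.{w, v, u}} {a b : A.obj} {f : a ⟶ b} {C : A.obj}
    {L : ColaxCone f C} {P Q : ∀ {X : A.obj}, ColaxCone f X → Prop}
    (h : ∀ {X : A.obj} (c : ColaxCone f X), P c ↔ Q c) (hL : L.IsUniversal P) :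
    L.IsUniversal Q := by
  obtain rfl : @P = @Q := by
    funext X c; exact propext (h c)
  exact hL

theorem FCat.HasColaxLimits.hasConeLimits {A : FCat.{w, v, u}} (hA : A.HasColaxLimits) :
    A.HasConeLimits False := fun f => by
  obtain ⟨C, L, hL⟩ := hA f
  exact ⟨C, L, hL.congr fun _ => by simp⟩

theorem FCat.HasPseudoLimits.hasConeLimits {A : FCat.{w, v, u}} (hA : A.HasPseudoLimits) :
    A.HasConeLimits True := fun f => by
  obtain ⟨C, L, hL⟩ := hA f
  exact ⟨C, L, hL.congr fun _ => by simp⟩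

theorem FCat.orthogonal_j_of_lax {A Z W : FCat.{w, v, u}} (hA : A.HasColaxLimits) (m : Z ⟶ W)
    (hR : FFunctor.Refl (fun _ => True) m) (hM : FFunctor.Morph (fun _ => True) m)
    (hF : FFunctor.LocallyFaithful m) : Orthogonal A.j m :=
  FCat.orthogonal_j hA.hasConeLimits m
    (FFunctor.Refl.liftsReflections (P := fun _ => True) hR (by simp))
    (FFunctor.Morph.liftsReflectionMorphisms (P := fun _ => True) hM (by simp)) hF

/-- The inclusion of tight 1-cells is orthogonal to each `k`-doctrinal F-functor. -/
theorem FCat.orthogonal_j_of_wDoct (k : Weakness) {A Z W : FCat.{w, v, u}}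
    (hA : A.HasLimits k.bar) (m : Z ⟶ W) (hm : wDoct k m) : Orthogonal A.j m := by
  obtain ⟨hR, hM, hF⟩ := hm
  cases k with
  | l => exact FCat.orthogonal_j_of_lax hA m hR hM hF
  | p =>
    exact FCat.orthogonal_j (FCat.HasPseudoLimits.hasConeLimits hA) m
      (FFunctor.Refl.liftsReflections hR (by simp [LReflection.IsPseudo]))
      (FFunctor.Morph.liftsReflectionMorphisms hM (by simp [LReflection.IsPseudo])) hF
  | c =>
    -- For `c`, the limits and both doctrinal conditions are by definition the `l`-versions in the
    -- duals; only local faithfulness has to be transferred.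
    apply FFunctor.orthogonal_of_coHom
    have h := FCat.orthogonal_j_of_lax (A := A.co) hA (FFunctor.coHom m) hR hM hF.co
    rw [← FFunctor.coHom_j] at h
    exact h

theorem mainTheorem4 (k : Weakness) (A : FCat.{w, v, u}) (B : TwoCat.{w, v, u})
    (H : A ⟶ B.toFCat) (hA : A.HasLimits k.bar) (hH : wDoct k H) :
    IsOrthogonalDecomposition (leftOrthogonal (wDoct.{w, v, u} k)) (wDoct.{w, v, u} k)
      (TwoCat.toFFunctor (FFunctor.tau H)) A.j H where
  fac := FFunctor.ext_prelax rfl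
  left_mem := FCat.orthogonal_j_of_wDoct k hA
  right_mem := hH
  orthogonal _ m' he hm := he m' hm
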